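/- Let $T$ be a finite horizon, and let $x_t\in\mathbb R^n$ ($0\le t\le T$) and $u_t\in\mathbb R^m$ ($1\le t\le T$) be the states and inputs of a system; write $d(t)=(x_0,u_1,x_1,\dots,u_t,x_t)$. The system is linear-Gaussian, $$f(x_t\mid u_t,x_{t-1})=\mathcal N(A_tx_{t-1}+B_tu_t,\Sigma_\Xi),$$ and the ideal pdfs are ${}^I\!f(x_t\mid u_t,x_{t-1})=\mathcal N({}^I\!\mu_{t,x},{}^I\!\Sigma_{t,x})$ and ${}^I\!f(u_t\mid d(t-1))=\mathcal N({}^I\!\mu_{t,u},{}^I\!\Sigma_{t,u})$, where $\Sigma_\Xi$, ${}^I\!\Sigma_{t,x}$ and ${}^I\!\Sigma_{t,u}$ are positive definite and the means ${}^I\!\mu_{t,x}$, ${}^I\!\mu_{t,u}$ do not depend on the data. An admissible control strategy is a family of (jointly measurable) conditional pdfs $\pi(u_t\mid d(t-1))$, $1\le t\le T$. It is optimal if, for every $x_0$, it minimizes among all admissible strategies the Kullback-Leibler divergence of the pdf $\prod_{t=1}^T f(x_t\mid u_t,x_{t-1})\,\pi(u_t\mid d(t-1))$ from the pdf $\prod_{t=1}^T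 {}^I\!f(x_t\mid u_t,x_{t-1})\,{}^I\!f(u_t\mid d(t-1))$. Starting from $\gamma(d(T))=1$, define backwards for $t=T,\dots,1$ $$\omega(u_t,d(t-1))=\int f(x_t\mid u_t,x_{t-1})\log\frac{f(x_t\mid u_t,x_{t-1})}{\gamma(d(t))\,{}^I\!f(x_t\mid u_t,x_{t-1})}\,dx_t,$$ $$\gamma(d(t-1))=\int {}^I\!f(u_t\mid d(t-1))\,e^{-\omega(u_t,d(t-1))}\,du_t .$$ Then these integrals converge. The optimal admissible control strategy exists, has finite divergence, is unique (for every $x_0$ and $t$, up to a Lebesgue-null set of values of the remaining past data and of $u_t$), and is $$ {}^o\!f(u_t\mid d(t-1))=\frac{{}^I\!f(u_t\mid d(t-1))\,e^{-\omega(u_t,d(t-1))}}{\gamma(d(t-1))}=\mathcal N(\mu_{t,u},\Sigma_{t,u}),\qquad 1\le t\le T .$$ Moreover, for $0\le t\le T$, $$\gamma(d(t))=C_t\exp\!\Big(-\tfrac12(L_tx_t+M_t)^{\mathsf T}\Sigma_{t,\gamma}^{-1}(L_tx_t+M_t)\Big)$$ with constants $C_t>0$ that do not depend on the data. Here the parameters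 are given by the terminal conditions $L_T=0$, $M_T=0$, $\Sigma_{T,\gamma}^{-1}=0$ and, for $t=T,\dots,1$, by the backward recursions $$\Sigma_{t,\omega}^{-1}={}^I\!\Sigma_{t,x}^{-1}+L_t^{\mathsf T}\Sigma_{t,\gamma}^{-1}L_t,\qquad \mu_{t,\omega}=\Sigma_{t,\omega}\big({}^I\!\Sigma_{t,x}^{-1}\,{}^I\!\mu_{t,x}-L_t^{\mathsf T}\Sigma_{t,\gamma}^{-1}M_t\big),$$ $$\Sigma_{t,u}^{-1}={}^I\!\Sigma_{t,u}^{-1}+B_t^{\mathsf T}\Sigma_{t,\omega}^{-1}B_t,\qquad \mu_{t,u}=\Sigma_{t,u}\big({}^I\!\Sigma_{t,u}^{-1}\,{}^I\!\mu_{t,u}+B_t^{\mathsf T}\Sigma_{t,\omega}^{-1}(\mu_{t,\omega}-A_tx_{t-1})\big),$$ $$L_{t-1}=A_t,\qquad \Sigma_{t-1,\gamma}^{-1}=\big(B_t\,{}^I\!\Sigma_{t,u}B_t^{\mathsf T}+\Sigma_{t,\omega}\big)^{-1},$$ $$M_{t-1}=\Sigma_{t-1,\gamma}\,\Sigma_{t,\omega}^{-1}B_t\,\Sigma_{t,u}\,{}^I\!\Sigma_{t,u}^{-1}\,{}^I\!\mu_{t,u}-\mu_{t,\omega},$$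 in which $\Sigma_{t,\omega}$, $\Sigma_{t,u}$ and $\Sigma_{t-1,\gamma}$ are positive definite for $1\le t\le T$. -/

import Mathlib

open MeasureTheory

open scoped Matrix

noncomputable section

namespace FPC

/-! ### Datasets, models and control strategies -/

/-- One time step `(u_t, x_t)`: an `m`-dimensional input and an `n`-dimensional state. -/
abbrev Step (n m : ℕ) := (Fin m → ℝ) × (Fin n → ℝ)

/-- The dataset `d(t) = (x_0, u_1, x_1, …, u_t, x_t)`, stored as the pair of `x_0` and
`((u_1, x_1), …, (u_t, x_t))`; the pair `(u_{i+1}, x_{i+1})` has index `i`. -/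
abbrev Dataset (n m t : ℕ) := (Fin n → ℝ) × (Fin t → Step n m)

/-- The last state `x_t` of the dataset `d(t)`. -/
def Dataset.state {n m : ℕ} : {t : ℕ} → Dataset n m t → (Fin n → ℝ)
  | 0, d => d.1
  | t + 1, d => (d.2 (Fin.last t)).2

/-- The dataset `d(t+1)` obtained from `d(t)` by appending `u_{t+1}` and `x_{t+1}`. -/
def Dataset.snoc {n m t : ℕ} (d : Dataset n m t) (u : Fin m → ℝ) (x : Fin n → ℝ) :
    Dataset n m (t + 1) :=
  (d.1, Fin.snoc (α := fun _ => Step n m) d.2 (u, x))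

/-- The initial part `d(s)` of the dataset `d(t)`, for `s ≤ t`. -/
def Dataset.take {n m t : ℕ} (d : Dataset n m t) (s : ℕ) (h : s ≤ t) : Dataset n m s :=
  (d.1, fun i => d.2 (Fin.castLE h i))

/-- Families of transition pdfs: `f t x u y` is the value at `x_t = y` of the pdf
`f(x_t | u_t = u, x_{t-1} = x)`. Only times `1 ≤ t ≤ T` matter. -/
abbrev Model (n m : ℕ) := ℕ → (Fin n → ℝ) → (Fin m → ℝ) → (Fin n → ℝ) → ℝ

/-- Families of input pdfs: `π t d u` is the value at `u_{t+1} = u` of the pdf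
`f(u_{t+1} | d(t) = d)`. Only times `t < T` matter. -/
abbrev Policy (n m : ℕ) := (t : ℕ) → Dataset n m t → (Fin m → ℝ) → ℝ

/-- Admissible control strategies over the horizon `T`: each `π t` with `t < T` is a
(jointly measurable) conditional pdf of the input given the past dataset. -/
def IsAdmissible {n m : ℕ} (T : ℕ) (π : Policy n m) : Prop :=
  ∀ t < T,
    Measurable (fun q : Dataset n m t × (Fin m → ℝ) => π t q.1 q.2) ∧
    (∀ d u, 0 ≤ π t d u) ∧
    (∀ d, ∫⁻ u, ENNReal.ofReal (π t d u) = 1)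

/-- The joint pdf `∏_{t=1}^T f(x_t | u_t, x_{t-1}) π(u_t | d(t-1))` of
`(u_1, x_1, …, u_T, x_T)` given `x_0`. -/
def jointDensity {n m : ℕ} (T : ℕ) (f : Model n m) (π : Policy n m) (x₀ : Fin n → ℝ)
    (h : Fin T → Step n m) : ℝ :=
  ∏ i : Fin T,
    f (i + 1) (Dataset.take (x₀, h) i i.isLt.le).state (h i).1 (h i).2 *
      π i (Dataset.take (x₀, h) i i.isLt.le) (h i).1

/-- The law of `(u_1, x_1, …, u_T, x_T)` given `x_0`. -/
def jointLaw {n m : ℕ} (T : ℕ) (f : Model n m) (π : Policy n m) (x₀ : Fin n → ℝ) :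
    Measure (Fin T → Step n m) :=
  volume.withDensity fun h => ENNReal.ofReal (jointDensity T f π x₀ h)

/-- The Kullback-Leibler divergence, in `[0, ∞]`, of the closed-loop pdf (model `f`, control
strategy `π`) from the ideal pdf (model `fI`, input pdfs `πI`), given `x_0`. -/
def klCost {n m : ℕ} (T : ℕ) (f fI : Model n m) (πI π : Policy n m) (x₀ : Fin n → ℝ) : ENNReal :=
  InformationTheory.klDiv (jointLaw T f π x₀) (jointLaw T fI πI x₀)

/-- `π` is the optimal admissible control strategy: it is admissible and, for every `x_0`, its
divergence is finite and minimal among admissible strategies, and every other minimizer has the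
same input pdfs for almost every past and almost every input. -/
def IsOptimal {n m : ℕ} (T : ℕ) (f fI : Model n m) (πI π : Policy n m) : Prop :=
  IsAdmissible T π ∧
  ∀ x₀ : Fin n → ℝ,
    klCost T f fI πI π x₀ ≠ ⊤ ∧
    ∀ π' : Policy n m, IsAdmissible T π' →
      klCost T f fI πI π x₀ ≤ klCost T f fI πI π' x₀ ∧
      (klCost T f fI πI π' x₀ = klCost T f fI πI π x₀ →
        ∀ t < T, ∀ᵐ h : Fin t → Step n m, ∀ᵐ u : Fin m → ℝ, π' t (x₀, h) u = π t (x₀, h) u)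

/-! ### The functions `ω` and `γ` of fully probabilistic control -/

/-- The integrand `f log (f / (g fI))`, as a function of `y = x_{t+1}`, in the definition of
`ω(u_{t+1}, d(t))`; here `g` stands for `γ(d(t+1))`. -/
def omegaIntegrand {n m : ℕ} (f fI : Model n m) (t : ℕ) (g : Dataset n m (t + 1) → ℝ)
    (d : Dataset n m t) (u : Fin m → ℝ) (y : Fin n → ℝ) : ℝ :=
  f (t + 1) d.state u y *
    Real.log (f (t + 1) d.state u y / (g (d.snoc u y) * fI (t + 1) d.state u y))

/-- `γ(d(t))` when `k` steps remain until the horizon. -/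
def gammaAux {n m : ℕ} (f fI : Model n m) (πI : Policy n m) :
    ℕ → (t : ℕ) → Dataset n m t → ℝ
  | 0, _, _ => 1
  | k + 1, t, d =>
      ∫ u, πI t d u * Real.exp (-∫ y, omegaIntegrand f fI t (gammaAux f fI πI k (t + 1)) d u y)

/-- The normalizer `γ(d(t))`, for `t ≤ T`. -/
def gamma {n m : ℕ} (T : ℕ) (f fI : Model n m) (πI : Policy n m) (t : ℕ) (d : Dataset n m t) : ℝ :=
  gammaAux f fI πI (T - t) t d

/-- `ω(u_{t+1}, d(t))`, for `t < T`. -/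
def omega {n m : ℕ} (T : ℕ) (f fI : Model n m) (πI : Policy n m) (t : ℕ) (d : Dataset n m t)
    (u : Fin m → ℝ) : ℝ :=
  ∫ y, omegaIntegrand f fI t (gamma T f fI πI (t + 1)) d u y

theorem gamma_terminal {n m : ℕ} (T : ℕ) (f fI : Model n m) (πI : Policy n m)
    (d : Dataset n m T) : gamma T f fI πI T d = 1 := by
  simp [gamma, gammaAux]

theorem gamma_of_lt {n m : ℕ} (T : ℕ) (f fI : Model n m) (πI : Policy n m) (t : ℕ) (ht : t < T)
    (d : Dataset n m t) :
    gamma T f fI πI t d = ∫ u, πI t d u * Real.exp (-omega T f fI πI t d u) := by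
  obtain ⟨k, rfl⟩ := Nat.exists_eq_add_of_lt ht
  have h1 : t + k + 1 - t = k + 1 := by omega
  have h2 : gamma (t + k + 1) f fI πI (t + 1) = gammaAux f fI πI k (t + 1) := by
    funext e
    simp only [gamma]
    congr 1
    omega
  simp only [omega, h2]
  simp only [gamma, h1, gammaAux]

/-- The strategy `πI(u_{t+1} | d(t)) exp(-ω(u_{t+1}, d(t))) / γ(d(t))`. -/
def fpcPolicy {n m : ℕ} (T : ℕ) (f fI : Model n m) (πI : Policy n m) : Policy n m :=
  fun t d u => πI t d u * Real.exp (-omega T f fI πI t d u) / gamma T f fI πI t d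

/-! ### The linear-Gaussian case -/

/-- The pdf of the multivariate normal distribution `𝒩(μ, Σ)` on `ℝ^k`
(for positive definite `Σ`). -/
def gaussianDensity {k : ℕ} (μ : Fin k → ℝ) (Sig : Matrix (Fin k) (Fin k) ℝ) (x : Fin k → ℝ) : ℝ :=
  (Real.sqrt ((2 * Real.pi) ^ k * Sig.det))⁻¹ *
    Real.exp (-(1 / 2) * ((x - μ) ⬝ᵥ (Sig⁻¹ *ᵥ (x - μ))))

/-- The data of a linear-Gaussian control problem; the time-indexed entries are used at times
`1 ≤ t ≤ T` only. -/
structure LinearGaussian (n m : ℕ) where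
  /-- state matrices `A_t` -/
  A : ℕ → Matrix (Fin n) (Fin n) ℝ
  /-- input matrices `B_t` -/
  B : ℕ → Matrix (Fin n) (Fin m) ℝ
  /-- noise covariance `Σ_Ξ` -/
  SigmaXi : Matrix (Fin n) (Fin n) ℝ
  /-- means of the ideal state pdfs -/
  muIX : ℕ → Fin n → ℝ
  /-- covariances of the ideal state pdfs -/
  SigmaIX : ℕ → Matrix (Fin n) (Fin n) ℝ
  /-- means of the ideal input pdfs -/
  muIU : ℕ → Fin m → ℝ
  /-- covariances of the ideal input pdfs -/
  SigmaIU : ℕ → Matrix (Fin m) (Fin m) ℝ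

variable {n m : ℕ}

/-- `f(x_t | u_t, x_{t-1}) = 𝒩(A_t x_{t-1} + B_t u_t, Σ_Ξ)`. -/
def LinearGaussian.model (S : LinearGaussian n m) : Model n m :=
  fun t x u => gaussianDensity (S.A t *ᵥ x + S.B t *ᵥ u) S.SigmaXi

/-- The ideal state pdfs. -/
def LinearGaussian.idealModel (S : LinearGaussian n m) : Model n m :=
  fun t _ _ => gaussianDensity (S.muIX t) (S.SigmaIX t)

/-- The ideal input pdfs. -/
def LinearGaussian.idealPolicy (S : LinearGaussian n m) : Policy n m :=
  fun t _ => gaussianDensity (S.muIU (t + 1)) (S.SigmaIU (t + 1))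

/-- The control parameters. `SigmaGammaInv t` is the matrix written `Σ_{t,γ}⁻¹` (it vanishes at
the horizon), and `muU t x` is the mean `μ_{t,u}` as a function of `x = x_{t-1}`. -/
structure ControlParameters (n m : ℕ) where
  SigmaU : ℕ → Matrix (Fin m) (Fin m) ℝ
  muU : ℕ → (Fin n → ℝ) → Fin m → ℝ
  L : ℕ → Matrix (Fin n) (Fin n) ℝ
  M : ℕ → Fin n → ℝ
  SigmaGammaInv : ℕ → Matrix (Fin n) (Fin n) ℝ
  SigmaOmega : ℕ → Matrix (Fin n) (Fin n) ℝ
  muOmega : ℕ → Fin n → ℝ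

/-- The terminal conditions and the backward recursions for the control parameters. The
positive definiteness conditions say that all the inverses are genuine. -/
structure ControlParameters.Recursion (p : ControlParameters n m) (S : LinearGaussian n m)
    (T : ℕ) : Prop where
  L_terminal : p.L T = 0
  M_terminal : p.M T = 0
  SigmaGammaInv_terminal : p.SigmaGammaInv T = 0
  SigmaOmega_posDef : ∀ t < T, (p.SigmaOmega (t + 1)).PosDef
  SigmaU_posDef : ∀ t < T, (p.SigmaU (t + 1)).PosDef
  SigmaGammaInv_posDef : ∀ t < T, (p.SigmaGammaInv t).PosDef
  SigmaOmega_inv : ∀ t < T, (p.SigmaOmega (t + 1))⁻¹ =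
    (S.SigmaIX (t + 1))⁻¹ + (p.L (t + 1))ᵀ * p.SigmaGammaInv (t + 1) * p.L (t + 1)
  muOmega_eq : ∀ t < T, p.muOmega (t + 1) =
    p.SigmaOmega (t + 1) *ᵥ ((S.SigmaIX (t + 1))⁻¹ *ᵥ S.muIX (t + 1)
      - ((p.L (t + 1))ᵀ * p.SigmaGammaInv (t + 1)) *ᵥ p.M (t + 1))
  SigmaU_inv : ∀ t < T, (p.SigmaU (t + 1))⁻¹ =
    (S.SigmaIU (t + 1))⁻¹ + (S.B (t + 1))ᵀ * (p.SigmaOmega (t + 1))⁻¹ * S.B (t + 1)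
  muU_eq : ∀ t < T, ∀ x, p.muU (t + 1) x =
    p.SigmaU (t + 1) *ᵥ ((S.SigmaIU (t + 1))⁻¹ *ᵥ S.muIU (t + 1)
      + ((S.B (t + 1))ᵀ * (p.SigmaOmega (t + 1))⁻¹) *ᵥ (p.muOmega (t + 1) - S.A (t + 1) *ᵥ x))
  L_eq : ∀ t < T, p.L t = S.A (t + 1)
  SigmaGammaInv_eq : ∀ t < T, p.SigmaGammaInv t =
    (S.B (t + 1) * S.SigmaIU (t + 1) * (S.B (t + 1))ᵀ + p.SigmaOmega (t + 1))⁻¹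
  M_eq : ∀ t < T, p.M t =
    (p.SigmaGammaInv t)⁻¹ *ᵥ (((p.SigmaOmega (t + 1))⁻¹ * S.B (t + 1) * p.SigmaU (t + 1)
      * (S.SigmaIU (t + 1))⁻¹) *ᵥ S.muIU (t + 1)) - p.muOmega (t + 1)

/-- The Gaussian strategy `𝒩(μ_{t,u}, Σ_{t,u})`. -/
def ControlParameters.policy (p : ControlParameters n m) : Policy n m :=
  fun t d => gaussianDensity (p.muU (t + 1) d.state) (p.SigmaU (t + 1))

end FPC

end

noncomputable section

namespace FPC

/-! The proof is dynamic programming made exact. With `V t = -log γ(d(t))`, consider the divergence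
of the two joint densities up to time `t` plus the expectation of `V t`. At `t = 0` this is `V 0`;
at `t = T` it is the full divergence, because `V T = 0`. Passing from `t` to `t + 1` adds exactly
the expected relative entropy of the chosen input pdf with respect to the tilted pdf `πI exp(-ω) /
γ`: this is the chain rule (`lintegral_klTerm_mul`) combined with the Gibbs variational identity
(`lintegral_klTerm_tilt`). So the cost of every admissible strategy is `V 0` plus a sum of
nonnegative regrets (`klCost_eq_value_add_regret`). The tilted strategy has zero regret, and zero
regret forces equality almost everywhere since all densities in play are positive
(`isOptimal_tiltPolicy`).

All these identities live in `[0, ∞]`, so strategies of infinite cost need no separate treatment.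
The price is that every term must be nonnegative: the integrand `p log (p / q) + q - p` replaces `p
log (p / q)`, and `γ ≤ 1` is needed for `V ≥ 0` (`gamma_le_one`).

In the linear-Gaussian case, `ω` is a Gaussian expectation of quadratics, hence a constant plus a
quadratic form in `A x + B u - μ_ω` (`omega_eq_quadForm`). Multiplying the ideal input pdf by
`exp(-ω)` is then a Bayesian update, which splits into the marginal form of `γ` times a normalized
Gaussian in `u` (`quadForm_posterior_marginal`, `idealPolicy_mul_exp_neg_omega`). Backward induction
closes the recursion. -/

/-! ### The Kullback-Leibler integrand -/

/-- The nonnegative integrand `p log (p / q) + q - p` of the Kullback-Leibler divergence. -/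
def klTerm (p q : ℝ) : ℝ := q * InformationTheory.klFun (p / q)

theorem klTerm_eq {p q : ℝ} (hq : 0 < q) : klTerm p q = p * Real.log (p / q) + q - p := by
  rw [klTerm, InformationTheory.klFun_apply]
  field_simp

theorem klTerm_nonneg {p q : ℝ} (hp : 0 ≤ p) (hq : 0 < q) : 0 ≤ klTerm p q :=
  mul_nonneg hq.le (InformationTheory.klFun_nonneg (div_nonneg hp hq.le))

theorem klTerm_eq_zero_iff {p q : ℝ} (hp : 0 ≤ p) (hq : 0 < q) : klTerm p q = 0 ↔ p = q := by
  rw [klTerm, mul_eq_zero, or_iff_right hq.ne',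
    InformationTheory.klFun_eq_zero_iff (div_nonneg hp hq.le), div_eq_one_iff_eq hq.ne']

theorem klTerm_self {q : ℝ} (hq : 0 < q) : klTerm q q = 0 :=
  (klTerm_eq_zero_iff hq.le hq).2 rfl

theorem _root_.Measurable.klTerm {α : Type*} [MeasurableSpace α] {p q : α → ℝ} (hp : Measurable p)
    (hq : Measurable q) : Measurable fun x => klTerm (p x) (q x) :=
  hq.mul (InformationTheory.measurable_klFun.comp (hp.div hq))

theorem klTerm_mul_add {a b c d : ℝ} (hc : 0 < c) (hd : 0 < d) :
    klTerm (a * b) (c * d) + (a * d + c * b) =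
      a * klTerm b d + b * klTerm a c + (a * b + c * d) := by
  rw [klTerm_eq (mul_pos hc hd), klTerm_eq hc, klTerm_eq hd]
  rcases eq_or_ne a 0 with rfl | ha
  · simp
    ring
  rcases eq_or_ne b 0 with rfl | hb
  · simp
    ring
  rw [mul_div_mul_comm, Real.log_mul (div_ne_zero ha hc.ne') (div_ne_zero hb hd.ne')]
  ring

/-- Pointwise Gibbs identity: tilting `q` by `exp(v - w)` changes `p log (p / q)` by `p (w - v)`.
The remaining terms compensate for the masses. -/
theorem klTerm_tilt {p q w v : ℝ} (hq : 0 < q) :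
    klTerm p q + p * w + q * Real.exp (-w) * Real.exp v =
      klTerm p (q * Real.exp (-w) * Real.exp v) + p * v + q := by
  rw [klTerm_eq hq, klTerm_eq (by positivity)]
  rcases eq_or_ne p 0 with rfl | hp
  · simp
    ring
  have h : p / (q * Real.exp (-w) * Real.exp v) = p / q * Real.exp (w - v) := by
    rw [Real.exp_sub, Real.exp_neg]
    field_simp
  rw [h, Real.log_mul (div_ne_zero hp hq.ne') (Real.exp_ne_zero _), Real.log_exp]
  ring

section Integrals

variable {α : Type*} [MeasurableSpace α] {μ : Measure α}

/-- The chain rule for the Kullback-Leibler integrand, integrated over the second factor. -/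
theorem lintegral_klTerm_mul {a c : ℝ} {b d : α → ℝ} (ha : 0 ≤ a) (hc : 0 < c)
    (hb : Measurable b) (hb0 : ∀ x, 0 ≤ b x) (hb1 : ∫⁻ x, ENNReal.ofReal (b x) ∂μ = 1)
    (hd : Measurable d) (hd0 : ∀ x, 0 < d x) (hd1 : ∫⁻ x, ENNReal.ofReal (d x) ∂μ = 1) :
    ∫⁻ x, ENNReal.ofReal (klTerm (a * b x) (c * d x)) ∂μ =
      ENNReal.ofReal (klTerm a c) +
        ENNReal.ofReal a * ∫⁻ x, ENNReal.ofReal (klTerm (b x) (d x)) ∂μ := by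
  have key : ∀ x, ENNReal.ofReal (klTerm (a * b x) (c * d x)) +
      (ENNReal.ofReal a * ENNReal.ofReal (d x) + ENNReal.ofReal c * ENNReal.ofReal (b x)) =
      ENNReal.ofReal a * ENNReal.ofReal (klTerm (b x) (d x)) +
        ENNReal.ofReal (klTerm a c) * ENNReal.ofReal (b x) +
        (ENNReal.ofReal a * ENNReal.ofReal (b x) + ENNReal.ofReal c * ENNReal.ofReal (d x)) := by
    intro x
    have h1 := klTerm_nonneg (mul_nonneg ha (hb0 x)) (mul_pos hc (hd0 x))
    have h2 := klTerm_nonneg (hb0 x) (hd0 x)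
    have h3 := klTerm_nonneg ha hc
    have h4 := hb0 x
    have h5 := (hd0 x).le
    have h6 := hc.le
    simp only [← ENNReal.ofReal_mul ha, ← ENNReal.ofReal_mul h3, ← ENNReal.ofReal_mul h6]
    rw [← ENNReal.ofReal_add (by positivity) (by positivity),
      ← ENNReal.ofReal_add (by positivity) (by positivity),
      ← ENNReal.ofReal_add (by positivity) (by positivity),
      ← ENNReal.ofReal_add (by positivity) (by positivity),
      ← ENNReal.ofReal_add (by positivity) (by positivity), klTerm_mul_add hc (hd0 x),
      mul_comm (b x) (klTerm a c)]
  have hbm := hb.ennreal_ofReal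
  have hdm := hd.ennreal_ofReal
  have hkm := (hb.klTerm hd).ennreal_ofReal
  have h := lintegral_congr (μ := μ) key
  rw [lintegral_add_right _ (by fun_prop), lintegral_add_right _ (by fun_prop),
    lintegral_add_right _ (by fun_prop), lintegral_add_right _ (by fun_prop),
    lintegral_add_right _ (by fun_prop)] at h
  simp only [lintegral_const_mul _ hbm, lintegral_const_mul _ hdm, lintegral_const_mul _ hkm,
    hb1, hd1, mul_one] at h
  -- After integration both compensating brackets equal `a + c`, which is finite and cancels even
  -- when a divergence is infinite.
  rw [ENNReal.add_left_inj (by simp)] at h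
  rw [h, add_comm]

/-- The Gibbs variational identity: relative entropy plus energy is the relative entropy with
respect to the tilted density plus the free energy. -/
theorem lintegral_klTerm_tilt {p q w : α → ℝ} {v : ℝ} (hv : 0 ≤ v)
    (hp : Measurable p) (hp0 : ∀ x, 0 ≤ p x) (hp1 : ∫⁻ x, ENNReal.ofReal (p x) ∂μ = 1)
    (hq : Measurable q) (hq0 : ∀ x, 0 < q x) (hq1 : ∫⁻ x, ENNReal.ofReal (q x) ∂μ = 1)
    (hw : Measurable w) (hw0 : ∀ x, 0 ≤ w x)
    (hr1 : ∫⁻ x, ENNReal.ofReal (q x * Real.exp (-w x) * Real.exp v) ∂μ = 1) :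
    ∫⁻ x, ENNReal.ofReal (klTerm (p x) (q x)) ∂μ +
        ∫⁻ x, ENNReal.ofReal (p x) * ENNReal.ofReal (w x) ∂μ =
      ∫⁻ x, ENNReal.ofReal (klTerm (p x) (q x * Real.exp (-w x) * Real.exp v)) ∂μ +
        ENNReal.ofReal v := by
  have key : ∀ x, ENNReal.ofReal (klTerm (p x) (q x)) +
      ENNReal.ofReal (p x) * ENNReal.ofReal (w x) +
      ENNReal.ofReal (q x * Real.exp (-w x) * Real.exp v) =
      ENNReal.ofReal (klTerm (p x) (q x * Real.exp (-w x) * Real.exp v)) +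
        ENNReal.ofReal v * ENNReal.ofReal (p x) + ENNReal.ofReal (q x) := by
    intro x
    have hr : 0 < q x * Real.exp (-w x) * Real.exp v := by have := hq0 x; positivity
    have h1 := klTerm_nonneg (hp0 x) (hq0 x)
    have h2 := klTerm_nonneg (hp0 x) hr
    have h3 := hp0 x
    have h4 := (hq0 x).le
    have h5 := hw0 x
    rw [← ENNReal.ofReal_mul h3, ← ENNReal.ofReal_mul hv,
      ← ENNReal.ofReal_add h1 (by positivity),
      ← ENNReal.ofReal_add (by positivity) (by positivity),
      ← ENNReal.ofReal_add h2 (by positivity),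
      ← ENNReal.ofReal_add (by positivity) (by positivity), klTerm_tilt (hq0 x), mul_comm v]
  have hr : Measurable fun x => q x * Real.exp (-w x) * Real.exp v := by fun_prop
  have hrm := hr.ennreal_ofReal
  have hpm := hp.ennreal_ofReal
  have hqm := hq.ennreal_ofReal
  have hwm := hw.ennreal_ofReal
  have h := lintegral_congr (μ := μ) key
  rw [lintegral_add_right _ hrm, lintegral_add_right _ (by fun_prop),
    lintegral_add_right _ hqm, lintegral_add_right _ (by fun_prop),
    lintegral_const_mul _ hpm, hp1, hr1, hq1, mul_one, ENNReal.add_left_inj (by simp)] at h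
  exact h

/-- Since `q > 0`, the first measure has density `p / q` with respect to the second. This gives
absolute continuity and identifies the Radon-Nikodym derivative. -/
theorem klDiv_withDensity_ofReal [SFinite μ] {p q : α → ℝ}
    (hp : Measurable p) (hp0 : ∀ x, 0 ≤ p x) (hp1 : ∫⁻ x, ENNReal.ofReal (p x) ∂μ = 1)
    (hq : Measurable q) (hq0 : ∀ x, 0 < q x) (hq1 : ∫⁻ x, ENNReal.ofReal (q x) ∂μ = 1) :
    InformationTheory.klDiv (μ.withDensity fun x => ENNReal.ofReal (p x))
        (μ.withDensity fun x => ENNReal.ofReal (q x)) =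
      ∫⁻ x, ENNReal.ofReal (klTerm (p x) (q x)) ∂μ := by
  have hpm := hp.ennreal_ofReal
  have hqm := hq.ennreal_ofReal
  have hdm : Measurable fun x => ENNReal.ofReal (p x / q x) := (hp.div hq).ennreal_ofReal
  have hP : μ.withDensity (fun x => ENNReal.ofReal (p x)) =
      (μ.withDensity fun x => ENNReal.ofReal (q x)).withDensity
        fun x => ENNReal.ofReal (p x / q x) := by
    rw [← withDensity_mul _ hqm hdm]
    congr 1
    funext x
    rw [Pi.mul_apply, ← ENNReal.ofReal_mul (hq0 x).le, mul_div_cancel₀ _ (hq0 x).ne']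
  have : IsFiniteMeasure (μ.withDensity fun x => ENNReal.ofReal (q x)) :=
    isFiniteMeasure_withDensity (by rw [hq1]; simp)
  have : IsFiniteMeasure (μ.withDensity fun x => ENNReal.ofReal (p x)) :=
    isFiniteMeasure_withDensity (by rw [hp1]; simp)
  have hac : μ.withDensity (fun x => ENNReal.ofReal (p x)) ≪
      μ.withDensity fun x => ENNReal.ofReal (q x) := by
    rw [hP]
    exact withDensity_absolutelyContinuous _ _
  have hrn := Measure.rnDeriv_withDensity (μ.withDensity fun x => ENNReal.ofReal (q x)) hdm
  rw [← hP] at hrn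
  have hcong : ∫⁻ x, ENNReal.ofReal (InformationTheory.klFun
        ((μ.withDensity fun x => ENNReal.ofReal (p x)).rnDeriv
          (μ.withDensity fun x => ENNReal.ofReal (q x)) x).toReal)
        ∂(μ.withDensity fun x => ENNReal.ofReal (q x)) =
      ∫⁻ x, ENNReal.ofReal (InformationTheory.klFun (p x / q x))
        ∂(μ.withDensity fun x => ENNReal.ofReal (q x)) := by
    refine lintegral_congr_ae ?_
    filter_upwards [hrn] with x hx
    rw [hx, ENNReal.toReal_ofReal (div_nonneg (hp0 x) (hq0 x).le)]
  have hkm : Measurable fun x => ENNReal.ofReal (InformationTheory.klFun (p x / q x)) :=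
    (InformationTheory.measurable_klFun.comp (hp.div hq)).ennreal_ofReal
  rw [InformationTheory.klDiv_eq_lintegral_klFun_of_ac hac, hcong,
    lintegral_withDensity_eq_lintegral_mul _ hqm hkm]
  refine lintegral_congr fun x => ?_
  rw [Pi.mul_apply, klTerm, ← ENNReal.ofReal_mul (hq0 x).le]

end Integrals

/-! ### Datasets -/

section Datasets

variable {n m : ℕ}

@[simp]
theorem Dataset.snoc_state {t : ℕ} (d : Dataset n m t) (u : Fin m → ℝ) (x : Fin n → ℝ) :
    (d.snoc u x).state = x := by
  simp [Dataset.snoc, Dataset.state]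

theorem Dataset.measurable_state {t : ℕ} :
    Measurable (Dataset.state : Dataset n m t → Fin n → ℝ) := by
  cases t with
  | zero => exact measurable_fst
  | succ t =>
    change Measurable fun d : Dataset n m (t + 1) => (d.2 (Fin.last t)).2
    fun_prop

theorem Dataset.measurable_take {t s : ℕ} (h : s ≤ t) :
    Measurable fun d : Dataset n m t => d.take s h := by
  unfold Dataset.take
  fun_prop

theorem Dataset.take_snoc {t : ℕ} (x₀ : Fin n → ℝ) (h : Fin t → Step n m) (s : Step n m) (i : ℕ)
    (hi : i ≤ t) :
    Dataset.take (t := t + 1) (x₀, Fin.snoc (α := fun _ => Step n m) h s) i (hi.trans t.le_succ) =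
      Dataset.take (x₀, h) i hi := by
  simp only [Dataset.take, Prod.mk.injEq, true_and]
  funext j
  have : Fin.castLE (hi.trans t.le_succ) j = (Fin.castLE hi j).castSucc := rfl
  rw [this, Fin.snoc_castSucc]

theorem Dataset.take_self {t : ℕ} (d : Dataset n m t) : d.take t le_rfl = d := rfl

theorem jointDensity_zero (f : Model n m) (π : Policy n m) (x₀ : Fin n → ℝ)
    (h : Fin 0 → Step n m) : jointDensity 0 f π x₀ h = 1 := by
  simp [jointDensity]

theorem jointDensity_snoc (t : ℕ) (f : Model n m) (π : Policy n m) (x₀ : Fin n → ℝ)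
    (h : Fin t → Step n m) (u : Fin m → ℝ) (x : Fin n → ℝ) :
    jointDensity (t + 1) f π x₀ (Fin.snoc (α := fun _ => Step n m) h (u, x)) =
      jointDensity t f π x₀ h * π t (x₀, h) u *
        f (t + 1) (Dataset.state (t := t) (x₀, h)) u x := by
  rw [jointDensity, Fin.prod_univ_castSucc, mul_assoc, mul_comm (π t _ u)]
  congr 1
  · rw [jointDensity]
    refine Finset.prod_congr rfl fun i _ => ?_
    simp only [Fin.snoc_castSucc, Fin.val_castSucc, Dataset.take_snoc x₀ h (u, x) i i.isLt.le]
  · simp only [Fin.snoc_last, Fin.val_last, Dataset.take_snoc x₀ h (u, x) t le_rfl,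
      Dataset.take_self]

theorem measurePreserving_snoc (t : ℕ) :
    MeasurePreserving (fun q : (Fin t → Step n m) × Step n m =>
      (Fin.snoc (α := fun _ => Step n m) q.1 q.2 : Fin (t + 1) → Step n m)) := by
  have h := (volume_preserving_piFinSuccAbove (fun _ : Fin (t + 1) => Step n m) (Fin.last t)).symm
  have hs : MeasurePreserving (Prod.swap : (Fin t → Step n m) × Step n m → _) volume volume :=
    Measure.measurePreserving_swap
  have e : (fun q : (Fin t → Step n m) × Step n m =>
      (Fin.snoc (α := fun _ => Step n m) q.1 q.2 : Fin (t + 1) → Step n m)) =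
      (MeasurableEquiv.piFinSuccAbove (fun _ : Fin (t + 1) => Step n m) (Fin.last t)).symm ∘
        Prod.swap := by
    funext q
    simp [MeasurableEquiv.piFinSuccAbove, Fin.insertNthEquiv, Fin.insertNth_last']
  rw [e]
  exact h.comp hs

theorem lintegral_snoc (t : ℕ) {F : (Fin (t + 1) → Step n m) → ENNReal} (hF : Measurable F) :
    ∫⁻ h, F h = ∫⁻ h : Fin t → Step n m, ∫⁻ u : Fin m → ℝ, ∫⁻ x : Fin n → ℝ,
      F (Fin.snoc (α := fun _ => Step n m) h (u, x)) := by
  rw [← (measurePreserving_snoc t).lintegral_comp hF]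
  have hG : Measurable fun q : (Fin t → Step n m) × Step n m =>
      F (Fin.snoc (α := fun _ => Step n m) q.1 q.2) :=
    hF.comp (measurePreserving_snoc t).measurable
  rw [Measure.volume_eq_prod, lintegral_prod _ hG.aemeasurable]
  refine lintegral_congr fun h => ?_
  rw [Measure.volume_eq_prod, lintegral_prod]
  exact (hG.comp measurable_prodMk_left).aemeasurable

/-- By Tonelli, the indicator of the exceptional set has integral zero. -/
theorem ae_snoc (t : ℕ) {P : (Fin (t + 1) → Step n m) → Prop} (hP : MeasurableSet {h | P h})
    (H : ∀ᵐ h : Fin t → Step n m, ∀ᵐ u : Fin m → ℝ, ∀ x : Fin n → ℝ,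
      P (Fin.snoc (α := fun _ => Step n m) h (u, x))) :
    ∀ᵐ h, P h := by
  have hm : Measurable ({h | ¬ P h}.indicator (1 : (Fin (t + 1) → Step n m) → ENNReal)) :=
    measurable_one.indicator hP.compl
  rw [ae_iff, ← lintegral_indicator_one (s := {h | ¬ P h}) hP.compl, lintegral_snoc t hm]
  refine lintegral_eq_zero_of_ae_eq_zero ?_
  filter_upwards [H] with h hh
  refine lintegral_eq_zero_of_ae_eq_zero ?_
  filter_upwards [hh] with u hu
  refine lintegral_eq_zero_of_ae_eq_zero (Filter.Eventually.of_forall fun x => ?_)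
  simp [hu x]

end Datasets

/-! ### Verification theorem for fully probabilistic control -/

section Verification

variable {n m : ℕ}

/-- The transition pdfs of `f` up to the horizon `T` are jointly measurable, positive and
normalized. -/
structure IsPositiveModel (T : ℕ) (f : Model n m) : Prop where
  measurable : ∀ t < T, Measurable fun q : (Fin n → ℝ) × (Fin m → ℝ) × (Fin n → ℝ) =>
    f (t + 1) q.1 q.2.1 q.2.2
  pos : ∀ t < T, ∀ x u y, 0 < f (t + 1) x u y
  lintegral : ∀ t < T, ∀ x u, ∫⁻ y, ENNReal.ofReal (f (t + 1) x u y) = 1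

variable {T : ℕ} {f fI : Model n m} {π πI : Policy n m}

theorem IsPositiveModel.measurable_section (hf : IsPositiveModel T f) {t : ℕ} (ht : t < T)
    (x : Fin n → ℝ) (u : Fin m → ℝ) : Measurable (f (t + 1) x u) :=
  (hf.measurable t ht).comp (measurable_prodMk_left.comp measurable_prodMk_left)

theorem IsAdmissible.measurable_section (hπ : IsAdmissible T π) {t : ℕ} (ht : t < T)
    (d : Dataset n m t) : Measurable (π t d) :=
  (hπ t ht).1.comp measurable_prodMk_left

theorem jointDensity_nonneg (hf : IsPositiveModel T f) (hπ : IsAdmissible T π) {t : ℕ}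
    (ht : t ≤ T) (x₀ : Fin n → ℝ) (h : Fin t → Step n m) : 0 ≤ jointDensity t f π x₀ h :=
  Finset.prod_nonneg fun i _ =>
    mul_nonneg (hf.pos i (i.isLt.trans_le ht) _ _ _).le ((hπ i (i.isLt.trans_le ht)).2.1 _ _)

theorem jointDensity_pos (hf : IsPositiveModel T f) (hπ : ∀ t < T, ∀ d u, 0 < π t d u) {t : ℕ}
    (ht : t ≤ T) (x₀ : Fin n → ℝ) (h : Fin t → Step n m) : 0 < jointDensity t f π x₀ h :=
  Finset.prod_pos fun i _ =>
    mul_pos (hf.pos i (i.isLt.trans_le ht) _ _ _) (hπ i (i.isLt.trans_le ht) _ _)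

theorem measurable_jointDensity (hf : IsPositiveModel T f) (hπ : IsAdmissible T π) {t : ℕ}
    (ht : t ≤ T) (x₀ : Fin n → ℝ) : Measurable (jointDensity t f π x₀) := by
  refine Finset.measurable_fun_prod _ fun i _ => ?_
  have htake : Measurable fun h : Fin t → Step n m =>
      Dataset.take (t := t) (x₀, h) i i.isLt.le :=
    (Dataset.measurable_take i.isLt.le).comp measurable_prodMk_left
  have hi : Measurable fun h : Fin t → Step n m => h i := measurable_pi_apply i
  exact ((hf.measurable i (i.isLt.trans_le ht)).comp
      ((Dataset.measurable_state.comp htake).prodMk (hi.fst.prodMk hi.snd))).mul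
    ((hπ i (i.isLt.trans_le ht)).1.comp (htake.prodMk hi.fst))

theorem lintegral_fin_zero (F : (Fin 0 → Step n m) → ENNReal) (h₀ : Fin 0 → Step n m) :
    ∫⁻ h, F h = F h₀ := by
  rw [lintegral_unique, volume_pi, Measure.pi_univ, Finset.univ_eq_empty, Finset.prod_empty,
    mul_one]
  exact congrArg F (Subsingleton.elim _ _)

theorem lintegral_jointDensity (hf : IsPositiveModel T f) (hπ : IsAdmissible T π) {t : ℕ}
    (ht : t ≤ T) (x₀ : Fin n → ℝ) :
    ∫⁻ h, ENNReal.ofReal (jointDensity t f π x₀ h) = 1 := by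
  induction t with
  | zero =>
    rw [lintegral_fin_zero _ Fin.elim0, jointDensity_zero, ENNReal.ofReal_one]
  | succ t ih =>
    rw [lintegral_snoc t (measurable_jointDensity hf hπ ht x₀).ennreal_ofReal, ← ih (by omega)]
    refine lintegral_congr fun h => ?_
    have h0 := jointDensity_nonneg hf hπ (show t ≤ T by omega) x₀ h
    simp only [jointDensity_snoc]
    have hu : ∀ u, ∫⁻ x, ENNReal.ofReal (jointDensity t f π x₀ h * π t (x₀, h) u *
        f (t + 1) (Dataset.state (t := t) (x₀, h)) u x) =
        ENNReal.ofReal (jointDensity t f π x₀ h) * ENNReal.ofReal (π t (x₀, h) u) := by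
      intro u
      have h1 := (hπ t ht).2.1 (x₀, h) u
      simp only [ENNReal.ofReal_mul (mul_nonneg h0 h1)]
      rw [lintegral_const_mul _ (hf.measurable_section ht _ u).ennreal_ofReal,
        hf.lintegral t ht, mul_one, ENNReal.ofReal_mul h0]
    simp only [hu]
    rw [lintegral_const_mul _ (hπ.measurable_section ht _).ennreal_ofReal, (hπ t ht).2.2, mul_one]

theorem klCost_eq_lintegral (hf : IsPositiveModel T f) (hfI : IsPositiveModel T fI)
    (hπ : IsAdmissible T π) (hπI : IsAdmissible T πI) (hπI0 : ∀ t < T, ∀ d u, 0 < πI t d u)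
    (x₀ : Fin n → ℝ) :
    klCost T f fI πI π x₀ = ∫⁻ h, ENNReal.ofReal
      (klTerm (jointDensity T f π x₀ h) (jointDensity T fI πI x₀ h)) :=
  klDiv_withDensity_ofReal (measurable_jointDensity hf hπ le_rfl x₀)
    (jointDensity_nonneg hf hπ le_rfl x₀) (lintegral_jointDensity hf hπ le_rfl x₀)
    (measurable_jointDensity hfI hπI le_rfl x₀) (jointDensity_pos hfI hπI0 le_rfl x₀)
    (lintegral_jointDensity hfI hπI le_rfl x₀)

/-- The value functions `V t = -log γ(d(t))` and the functions `w t = ω` of a fully probabilistic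
control problem, in the form of the dynamic programming equations that they satisfy. -/
structure IsValue (T : ℕ) (f fI : Model n m) (πI : Policy n m)
    (V : (t : ℕ) → Dataset n m t → ℝ) (w : (t : ℕ) → Dataset n m t → (Fin m → ℝ) → ℝ) : Prop where
  measurable : ∀ t ≤ T, Measurable (V t)
  nonneg : ∀ t ≤ T, ∀ d, 0 ≤ V t d
  terminal : ∀ d, V T d = 0
  measurable_energy : ∀ t < T, Measurable fun q : Dataset n m t × (Fin m → ℝ) => w t q.1 q.2
  energy_nonneg : ∀ t < T, ∀ d u, 0 ≤ w t d u
  -- The left side is a real number, so this also asserts that the integral is finite.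
  energy_eq : ∀ t < T, ∀ d u, ENNReal.ofReal (w t d u) =
    ∫⁻ y, (ENNReal.ofReal (klTerm (f (t + 1) d.state u y) (fI (t + 1) d.state u y)) +
      ENNReal.ofReal (f (t + 1) d.state u y) * ENNReal.ofReal (V (t + 1) (d.snoc u y)))
  lintegral_tilt : ∀ t < T, ∀ d,
    ∫⁻ u, ENNReal.ofReal (πI t d u * Real.exp (-w t d u) * Real.exp (V t d)) = 1

/-- The strategy given by the tilted input pdfs. -/
def tiltPolicy (πI : Policy n m) (V : (t : ℕ) → Dataset n m t → ℝ)
    (w : (t : ℕ) → Dataset n m t → (Fin m → ℝ) → ℝ) : Policy n m :=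
  fun t d u => πI t d u * Real.exp (-w t d u) * Real.exp (V t d)

variable {V : (t : ℕ) → Dataset n m t → ℝ} {w : (t : ℕ) → Dataset n m t → (Fin m → ℝ) → ℝ}

/-- The expected relative entropy, under the strategy `π`, of the input pdf at time `t + 1` with
respect to the pdf of the strategy `ρ`. -/
def regret (f : Model n m) (π ρ : Policy n m) (x₀ : Fin n → ℝ) (t : ℕ) : ENNReal :=
  ∫⁻ h : Fin t → Step n m, ENNReal.ofReal (jointDensity t f π x₀ h) *
    ∫⁻ u, ENNReal.ofReal (klTerm (π t (x₀, h) u) (ρ t (x₀, h) u))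

theorem tiltPolicy_pos (hπI0 : ∀ t < T, ∀ d u, 0 < πI t d u) :
    ∀ t < T, ∀ d u, 0 < tiltPolicy πI V w t d u := fun t ht d u => by
  have := hπI0 t ht d u
  unfold tiltPolicy
  positivity

theorem isAdmissible_tiltPolicy (hπI : IsAdmissible T πI) (hπI0 : ∀ t < T, ∀ d u, 0 < πI t d u)
    (hV : IsValue T f fI πI V w) : IsAdmissible T (tiltPolicy πI V w) := fun t ht =>
  ⟨((hπI t ht).1.mul (hV.measurable_energy t ht).neg.exp).mul
      ((hV.measurable t ht.le).comp measurable_fst).exp,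
    fun d u => (tiltPolicy_pos hπI0 t ht d u).le, hV.lintegral_tilt t ht⟩

/-- One Bellman step. Integrating out `x_{t+1}` by the chain rule leaves the energy `w`; integrating
out `u_{t+1}` by the chain rule and the Gibbs identity turns relative entropy plus energy into
regret plus `V t`. -/
theorem lintegral_klTerm_add_value_succ (hf : IsPositiveModel T f) (hfI : IsPositiveModel T fI)
    (hπI : IsAdmissible T πI) (hπI0 : ∀ t < T, ∀ d u, 0 < πI t d u)
    (hV : IsValue T f fI πI V w) (hπ : IsAdmissible T π) (x₀ : Fin n → ℝ) {t : ℕ} (ht : t < T) :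
    ∫⁻ h, (ENNReal.ofReal (klTerm (jointDensity (t + 1) f π x₀ h)
        (jointDensity (t + 1) fI πI x₀ h)) +
      ENNReal.ofReal (jointDensity (t + 1) f π x₀ h) * ENNReal.ofReal (V (t + 1) (x₀, h))) =
    (∫⁻ h, (ENNReal.ofReal (klTerm (jointDensity t f π x₀ h) (jointDensity t fI πI x₀ h)) +
      ENNReal.ofReal (jointDensity t f π x₀ h) * ENNReal.ofReal (V t (x₀, h)))) +
      regret f π (tiltPolicy πI V w) x₀ t := by
  have hp1 := measurable_jointDensity hf hπ (show t + 1 ≤ T from ht) x₀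
  have hq1 := measurable_jointDensity hfI hπI (show t + 1 ≤ T from ht) x₀
  have hp := measurable_jointDensity hf hπ ht.le x₀
  have hq := measurable_jointDensity hfI hπI ht.le x₀
  have hV1 : Measurable fun h : Fin (t + 1) → Step n m => V (t + 1) (x₀, h) :=
    (hV.measurable (t + 1) ht).comp measurable_prodMk_left
  have hV0 : Measurable fun h : Fin t → Step n m => V t (x₀, h) :=
    (hV.measurable t ht.le).comp measurable_prodMk_left
  have hF1 : Measurable fun h => ENNReal.ofReal (klTerm (jointDensity (t + 1) f π x₀ h)
        (jointDensity (t + 1) fI πI x₀ h)) +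
      ENNReal.ofReal (jointDensity (t + 1) f π x₀ h) * ENNReal.ofReal (V (t + 1) (x₀, h)) :=
    (hp1.klTerm hq1).ennreal_ofReal.add (hp1.ennreal_ofReal.mul hV1.ennreal_ofReal)
  have hF0 : Measurable fun h => ENNReal.ofReal (klTerm (jointDensity t f π x₀ h)
        (jointDensity t fI πI x₀ h)) +
      ENNReal.ofReal (jointDensity t f π x₀ h) * ENNReal.ofReal (V t (x₀, h)) :=
    (hp.klTerm hq).ennreal_ofReal.add (hp.ennreal_ofReal.mul hV0.ennreal_ofReal)
  rw [lintegral_snoc t hF1, regret, ← lintegral_add_left hF0]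
  refine lintegral_congr fun h => ?_
  have ha := jointDensity_nonneg hf hπ ht.le x₀ h
  have hc := jointDensity_pos hfI hπI0 ht.le x₀ h
  simp only [jointDensity_snoc]
  -- With the past fixed, its two densities are just constants `a ≥ 0` and `c > 0`.
  generalize jointDensity t f π x₀ h = a at *
  generalize jointDensity t fI πI x₀ h = c at *
  set d : Dataset n m t := (x₀, h)
  have hπm := hπ.measurable_section ht d
  have hπIm := hπI.measurable_section ht d
  have hwm : Measurable (w t d) := (hV.measurable_energy t ht).comp measurable_prodMk_left
  have inner : ∀ u, ∫⁻ x, (ENNReal.ofReal (klTerm (a * π t d u * f (t + 1) d.state u x)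
        (c * πI t d u * fI (t + 1) d.state u x)) +
      ENNReal.ofReal (a * π t d u * f (t + 1) d.state u x) *
        ENNReal.ofReal (V (t + 1) (d.snoc u x))) =
      ENNReal.ofReal (klTerm (a * π t d u) (c * πI t d u)) +
        ENNReal.ofReal a * (ENNReal.ofReal (π t d u) * ENNReal.ofReal (w t d u)) := by
    intro u
    have hb := (hπ t ht).2.1 d u
    have hfm := hf.measurable_section ht d.state u
    have hfIm := hfI.measurable_section ht d.state u
    have hk1 : Measurable fun x => ENNReal.ofReal (klTerm (a * π t d u * f (t + 1) d.state u x)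
        (c * πI t d u * fI (t + 1) d.state u x)) :=
      ((hfm.const_mul _).klTerm (hfIm.const_mul _)).ennreal_ofReal
    have hk2 := (hfm.klTerm hfIm).ennreal_ofReal
    have hVm : Measurable fun x => ENNReal.ofReal (f (t + 1) d.state u x) *
        ENNReal.ofReal (V (t + 1) (d.snoc u x)) := by
      refine hfm.ennreal_ofReal.mul (Measurable.ennreal_ofReal (hV1.comp ?_))
      exact (measurePreserving_snoc t).measurable.comp
        (measurable_const.prodMk (measurable_const.prodMk measurable_id))
    rw [lintegral_add_left hk1, lintegral_klTerm_mul (mul_nonneg ha hb)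
      (mul_pos hc (hπI0 t ht d u)) hfm (fun x => (hf.pos t ht _ _ x).le) (hf.lintegral t ht _ _)
      hfIm (hfI.pos t ht _ _) (hfI.lintegral t ht _ _), hV.energy_eq t ht d u,
      lintegral_add_left hk2]
    have hsplit : ∀ x, ENNReal.ofReal (a * π t d u * f (t + 1) d.state u x) *
        ENNReal.ofReal (V (t + 1) (d.snoc u x)) = ENNReal.ofReal (a * π t d u) *
          (ENNReal.ofReal (f (t + 1) d.state u x) * ENNReal.ofReal (V (t + 1) (d.snoc u x))) := by
      intro x
      rw [ENNReal.ofReal_mul (mul_nonneg ha hb), mul_assoc]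
    simp only [hsplit]
    rw [lintegral_const_mul _ hVm, ENNReal.ofReal_mul ha, mul_add, mul_add, add_assoc, mul_assoc,
      mul_assoc]
  have hwp : Measurable fun u => ENNReal.ofReal (π t d u) * ENNReal.ofReal (w t d u) :=
    hπm.ennreal_ofReal.mul hwm.ennreal_ofReal
  refine (lintegral_congr inner).trans ?_
  rw [lintegral_add_right _ (hwp.const_mul _), lintegral_const_mul _ hwp,
    lintegral_klTerm_mul ha hc hπm ((hπ t ht).2.1 d) ((hπ t ht).2.2 d) hπIm (hπI0 t ht d)
      ((hπI t ht).2.2 d), add_assoc, ← mul_add,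
    lintegral_klTerm_tilt (hV.nonneg t ht.le d) hπm ((hπ t ht).2.1 d) ((hπ t ht).2.2 d) hπIm
      (hπI0 t ht d) ((hπI t ht).2.2 d) hwm (hV.energy_nonneg t ht d) (hV.lintegral_tilt t ht d),
    mul_add, add_assoc, add_comm (_ * ∫⁻ _, _)]
  rfl

/-- The divergence of any admissible strategy is the value at time `0` plus its total regret. -/
theorem klCost_eq_value_add_regret (hf : IsPositiveModel T f) (hfI : IsPositiveModel T fI)
    (hπI : IsAdmissible T πI) (hπI0 : ∀ t < T, ∀ d u, 0 < πI t d u)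
    (hV : IsValue T f fI πI V w) (hπ : IsAdmissible T π) (x₀ : Fin n → ℝ) :
    klCost T f fI πI π x₀ = ENNReal.ofReal (V 0 (x₀, Fin.elim0)) +
      ∑ t ∈ Finset.range T, regret f π (tiltPolicy πI V w) x₀ t := by
  have key : ∀ t ≤ T,
      ∫⁻ h, (ENNReal.ofReal (klTerm (jointDensity t f π x₀ h) (jointDensity t fI πI x₀ h)) +
        ENNReal.ofReal (jointDensity t f π x₀ h) * ENNReal.ofReal (V t (x₀, h))) =
      ENNReal.ofReal (V 0 (x₀, Fin.elim0)) +
        ∑ s ∈ Finset.range t, regret f π (tiltPolicy πI V w) x₀ s := by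
    intro t
    induction t with
    | zero =>
      intro _
      rw [lintegral_fin_zero _ Fin.elim0]
      simp [jointDensity_zero, klTerm_self]
    | succ t ih =>
      intro ht
      rw [lintegral_klTerm_add_value_succ hf hfI hπI hπI0 hV hπ x₀ ht, ih (by omega),
        Finset.sum_range_succ, add_assoc]
  rw [klCost_eq_lintegral hf hfI hπ hπI hπI0, ← key T le_rfl]
  simp [hV.terminal]

theorem regret_self {ρ : Policy n m} (hρ : ∀ t < T, ∀ d u, 0 < ρ t d u) (x₀ : Fin n → ℝ) {t : ℕ}
    (ht : t < T) : regret f ρ ρ x₀ t = 0 := by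
  simp [regret, klTerm_self (hρ t ht _ _)]

/-- Zero regret at time `t` gives `π = ρ` only where the joint density under `π` is positive.
Conversely, agreement with the positive `ρ` makes the next joint density positive almost everywhere.
The two facts feed each other in an induction on time. -/
theorem ae_eq_of_regret_eq_zero {ρ : Policy n m} (hf : IsPositiveModel T f)
    (hπ : IsAdmissible T π) (hρ : IsAdmissible T ρ) (hρ0 : ∀ t < T, ∀ d u, 0 < ρ t d u)
    (x₀ : Fin n → ℝ) (H : ∀ t < T, regret f π ρ x₀ t = 0) :
    ∀ t < T, ∀ᵐ h : Fin t → Step n m, ∀ᵐ u : Fin m → ℝ, π t (x₀, h) u = ρ t (x₀, h) u := by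
  have step : ∀ t < T, (∀ᵐ h, 0 < jointDensity t f π x₀ h) →
      ∀ᵐ h : Fin t → Step n m, ∀ᵐ u : Fin m → ℝ, π t (x₀, h) u = ρ t (x₀, h) u := by
    intro t ht hpos
    have hdata : Measurable fun q : (Fin t → Step n m) × (Fin m → ℝ) =>
        (((x₀, q.1) : Dataset n m t), q.2) := by fun_prop
    have hk : Measurable fun q : (Fin t → Step n m) × (Fin m → ℝ) =>
        ENNReal.ofReal (klTerm (π t (x₀, q.1) q.2) (ρ t (x₀, q.1) q.2)) :=
      (((hπ t ht).1.comp hdata).klTerm ((hρ t ht).1.comp hdata)).ennreal_ofReal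
    have h0 := H t ht
    have hF : Measurable fun h : Fin t → Step n m => ENNReal.ofReal (jointDensity t f π x₀ h) *
        ∫⁻ u, ENNReal.ofReal (klTerm (π t (x₀, h) u) (ρ t (x₀, h) u)) :=
      (measurable_jointDensity hf hπ ht.le x₀).ennreal_ofReal.mul hk.lintegral_prod_right'
    rw [regret, lintegral_eq_zero_iff hF] at h0
    filter_upwards [hpos, h0] with h hh hz
    have hz' := (mul_eq_zero.1 hz).resolve_left (by simpa using hh)
    have hkh : Measurable fun u => ENNReal.ofReal (klTerm (π t (x₀, h) u) (ρ t (x₀, h) u)) :=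
      hk.comp measurable_prodMk_left
    rw [lintegral_eq_zero_iff hkh] at hz'
    filter_upwards [hz'] with u hu
    have hle : klTerm (π t (x₀, h) u) (ρ t (x₀, h) u) ≤ 0 := ENNReal.ofReal_eq_zero.1 hu
    exact (klTerm_eq_zero_iff ((hπ t ht).2.1 _ _) (hρ0 t ht _ _)).1
      (hle.antisymm (klTerm_nonneg ((hπ t ht).2.1 _ _) (hρ0 t ht _ _)))
  have hpos : ∀ t ≤ T, ∀ᵐ h, 0 < jointDensity t f π x₀ h := by
    intro t
    induction t with
    | zero => exact fun _ => Filter.Eventually.of_forall fun h => by simp [jointDensity_zero]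
    | succ t ih =>
      intro ht
      refine ae_snoc t (measurableSet_lt measurable_const (measurable_jointDensity hf hπ ht x₀)) ?_
      filter_upwards [ih (by omega), step t ht (ih (by omega))] with h hh hu
      filter_upwards [hu] with u hu x
      rw [jointDensity_snoc, hu]
      exact mul_pos (mul_pos hh (hρ0 t ht _ _)) (hf.pos t ht _ _ _)
  exact fun t ht => step t ht (hpos t ht.le)

theorem isOptimal_tiltPolicy (hf : IsPositiveModel T f) (hfI : IsPositiveModel T fI)
    (hπI : IsAdmissible T πI) (hπI0 : ∀ t < T, ∀ d u, 0 < πI t d u)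
    (hV : IsValue T f fI πI V w) : IsOptimal T f fI πI (tiltPolicy πI V w) := by
  have hρ := isAdmissible_tiltPolicy hπI hπI0 hV
  have hρ0 : ∀ t < T, ∀ d u, 0 < tiltPolicy πI V w t d u := tiltPolicy_pos hπI0
  refine ⟨hρ, fun x₀ => ?_⟩
  have hcost := fun π' (hπ' : IsAdmissible T π') =>
    klCost_eq_value_add_regret hf hfI hπI hπI0 hV hπ' x₀
  have hopt : klCost T f fI πI (tiltPolicy πI V w) x₀ =
      ENNReal.ofReal (V 0 (x₀, Fin.elim0)) := by
    rw [hcost _ hρ, Finset.sum_eq_zero fun t ht =>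
      regret_self hρ0 x₀ (Finset.mem_range.1 ht), add_zero]
  refine ⟨by simp [hopt], fun π' hπ' => ⟨?_, fun heq => ?_⟩⟩
  · rw [hopt, hcost π' hπ']
    exact le_self_add
  · rw [hopt, hcost π' hπ'] at heq
    -- The value at time `0` is finite, so it cancels and the total regret vanishes.
    have hsum := (ENNReal.add_right_inj (c := 0) ENNReal.ofReal_ne_top).1
      (heq.trans (add_zero _).symm)
    exact ae_eq_of_regret_eq_zero hf hπ' hρ hρ0 x₀ fun t ht =>
      (Finset.sum_eq_zero_iff.1 hsum) t (Finset.mem_range.2 ht)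

end Verification

/-! ### Quadratic forms -/

section Quadratic

variable {k l : ℕ}

/-- The quadratic form `vᵀ K v`. -/
def quadForm (K : Matrix (Fin k) (Fin k) ℝ) (v : Fin k → ℝ) : ℝ := v ⬝ᵥ (K *ᵥ v)

theorem gaussianDensity_eq (μ : Fin k → ℝ) (Sig : Matrix (Fin k) (Fin k) ℝ) (x : Fin k → ℝ) :
    gaussianDensity μ Sig x = (Real.sqrt ((2 * Real.pi) ^ k * Sig.det))⁻¹ *
      Real.exp (-(1 / 2) * quadForm Sig⁻¹ (x - μ)) := rfl

theorem continuous_quadForm (K : Matrix (Fin k) (Fin k) ℝ) : Continuous (quadForm K) := by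
  unfold quadForm
  fun_prop

@[simp]
theorem quadForm_zero_right (K : Matrix (Fin k) (Fin k) ℝ) : quadForm K 0 = 0 := by
  simp [quadForm]

theorem quadForm_neg (K : Matrix (Fin k) (Fin k) ℝ) (v : Fin k → ℝ) :
    quadForm K (-v) = quadForm K v := by
  simp [quadForm, Matrix.mulVec_neg]

theorem quadForm_add_right (K : Matrix (Fin k) (Fin k) ℝ) (v w : Fin k → ℝ) :
    quadForm K (v + w) = quadForm K v + ((K + Kᵀ) *ᵥ w) ⬝ᵥ v + quadForm K w := by
  simp only [quadForm, Matrix.mulVec_add, dotProduct_add, add_dotProduct, Matrix.add_mulVec,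
    Matrix.mulVec_transpose]
  rw [← Matrix.dotProduct_mulVec, dotProduct_comm v (K *ᵥ w)]
  ring

theorem quadForm_mulVec (K : Matrix (Fin l) (Fin l) ℝ) (L : Matrix (Fin l) (Fin k) ℝ)
    (v : Fin k → ℝ) : quadForm K (L *ᵥ v) = quadForm (Lᵀ * K * L) v := by
  simp only [quadForm, ← Matrix.mulVec_mulVec]
  rw [Matrix.dotProduct_mulVec v Lᵀ, Matrix.vecMul_transpose]

theorem quadForm_add_left (K K' : Matrix (Fin k) (Fin k) ℝ) (v : Fin k → ℝ) :
    quadForm (K + K') v = quadForm K v + quadForm K' v := by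
  simp [quadForm, Matrix.add_mulVec]

theorem quadForm_nonneg {K : Matrix (Fin k) (Fin k) ℝ} (hK : K.PosSemidef) (v : Fin k → ℝ) :
    0 ≤ quadForm K v :=
  hK.dotProduct_mulVec_nonneg v

theorem transpose_eq_of_isHermitian {K : Matrix (Fin k) (Fin k) ℝ} (hK : K.IsHermitian) :
    Kᵀ = K := by
  simpa [Matrix.conjTranspose_eq_transpose_of_trivial] using hK.eq

theorem quadForm_add_of_isHermitian {K : Matrix (Fin k) (Fin k) ℝ} (hK : K.IsHermitian)
    (v w : Fin k → ℝ) :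
    quadForm K (v + w) = quadForm K v + 2 * ((K *ᵥ w) ⬝ᵥ v) + quadForm K w := by
  rw [quadForm_add_right, transpose_eq_of_isHermitian hK, Matrix.add_mulVec, add_dotProduct,
    two_mul]

/-- Completing the square. -/
theorem quadForm_sub_add_quadForm {P W : Matrix (Fin k) (Fin k) ℝ} {Γ : Matrix (Fin l) (Fin l) ℝ}
    {L : Matrix (Fin l) (Fin k) ℝ} {μ ν : Fin k → ℝ} {M : Fin l → ℝ} (hP : P.IsHermitian)
    (hΓ : Γ.IsHermitian) (hW : W = P + Lᵀ * Γ * L) (hν : W *ᵥ ν = P *ᵥ μ - (Lᵀ * Γ) *ᵥ M)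
    (a : Fin k → ℝ) :
    quadForm P (a - μ) + quadForm Γ (L *ᵥ a + M) =
      quadForm W (a - ν) + (quadForm P (ν - μ) + quadForm Γ (L *ᵥ ν + M)) := by
  have h1 : a - μ = (a - ν) + (ν - μ) := by abel
  have h2 : L *ᵥ a + M = L *ᵥ (a - ν) + (L *ᵥ ν + M) := by
    rw [Matrix.mulVec_sub]
    abel
  -- Stationarity of the sum of the two forms at `ν`; this kills the cross terms.
  have h3 : P *ᵥ (ν - μ) + (Lᵀ * Γ) *ᵥ (L *ᵥ ν + M) = 0 := by
    rw [Matrix.mulVec_sub, Matrix.mulVec_add, Matrix.mulVec_mulVec, ← sub_eq_zero.2 hν, hW,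
      Matrix.add_mulVec]
    abel
  have h4 : (Γ *ᵥ (L *ᵥ ν + M)) ⬝ᵥ (L *ᵥ (a - ν)) =
      ((Lᵀ * Γ) *ᵥ (L *ᵥ ν + M)) ⬝ᵥ (a - ν) := by
    rw [Matrix.dotProduct_mulVec, ← Matrix.mulVec_transpose, ← Matrix.mulVec_mulVec]
  have h5 := congrArg (fun v => v ⬝ᵥ (a - ν)) h3
  simp only [add_dotProduct, zero_dotProduct] at h5
  rw [h1, h2, quadForm_add_of_isHermitian hP, quadForm_add_of_isHermitian hΓ, quadForm_mulVec, h4,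
    hW, quadForm_add_left]
  linear_combination 2 * h5

end Quadratic

/-! ### Gaussian integrals -/

section Gaussian

variable {k l : ℕ}

open scoped MatrixOrder Matrix.Norms.L2Operator in
-- The substitution `w = R z` reduces every Gaussian integral to the standard one. The factor `R`
-- comes from positivity in the C*-algebra of matrices, hence the opened order and norm.
theorem exists_eq_transpose_mul_self {P : Matrix (Fin k) (Fin k) ℝ} (hP : P.PosDef) :
    ∃ R : Matrix (Fin k) (Fin k) ℝ, P = Rᵀ * R ∧ R.det ≠ 0 := by
  obtain ⟨R, hR⟩ := CStarAlgebra.nonneg_iff_eq_star_mul_self.mp hP.posSemidef.nonneg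
  refine ⟨R, by simpa [Matrix.star_eq_conjTranspose] using hR, fun h => hP.det_pos.ne' ?_⟩
  rw [hR, Matrix.det_mul, h, mul_zero]

theorem map_mulVec_volume {R : Matrix (Fin k) (Fin k) ℝ} (hR : R.det ≠ 0) :
    Measure.map (fun z => R *ᵥ z) (volume : Measure (Fin k → ℝ)) =
      ENNReal.ofReal |R.det⁻¹| • volume :=
  Real.map_matrix_volume_pi_eq_smul_volume_pi hR

theorem measurableEmbedding_mulVec {R : Matrix (Fin k) (Fin k) ℝ} (hR : R.det ≠ 0) :
    MeasurableEmbedding fun z : Fin k → ℝ => R *ᵥ z := by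
  have hc : Continuous fun z : Fin k → ℝ => R *ᵥ z := by fun_prop
  refine hc.measurableEmbedding fun a b h => ?_
  exact Matrix.mulVec_injective_of_isUnit ((Matrix.isUnit_iff_isUnit_det R).2 hR.isUnit) h

theorem integrable_exp_neg_dotProduct {c : ℝ} (hc : 0 < c) :
    Integrable fun w : Fin k → ℝ => Real.exp (-c * (w ⬝ᵥ w)) := by
  have h : (fun w : Fin k → ℝ => Real.exp (-c * (w ⬝ᵥ w))) =
      fun w => ∏ i, Real.exp (-c * w i ^ 2) := by
    funext w
    rw [← Real.exp_sum, ← Finset.mul_sum]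
    simp [dotProduct, sq]
  rw [h]
  exact Integrable.fintype_prod (f := fun _ x => Real.exp (-c * x ^ 2))
    fun _ => integrable_exp_neg_mul_sq hc

theorem integral_exp_neg_half_dotProduct :
    ∫ w : Fin k → ℝ, Real.exp (-(1 / 2) * (w ⬝ᵥ w)) = Real.sqrt ((2 * Real.pi) ^ k) := by
  have h : (fun w : Fin k → ℝ => Real.exp (-(1 / 2) * (w ⬝ᵥ w))) =
      fun w => ∏ i, Real.exp (-(1 / 2) * w i ^ 2) := by
    funext w
    rw [← Real.exp_sum, ← Finset.mul_sum]
    simp [dotProduct, sq]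
  rw [h, integral_fintype_prod_volume_eq_pow (fun x : ℝ => Real.exp (-(1 / 2) * x ^ 2)),
    integral_gaussian, Fintype.card_fin, Real.sqrt_eq_rpow, Real.sqrt_eq_rpow,
    ← Real.rpow_natCast, ← Real.rpow_natCast, ← Real.rpow_mul (by positivity),
    ← Real.rpow_mul (by positivity), mul_comm (k : ℝ)]
  congr 1
  ring

theorem quadForm_transpose_mul_self (R : Matrix (Fin k) (Fin k) ℝ) (z : Fin k → ℝ) :
    quadForm (Rᵀ * R) z = (R *ᵥ z) ⬝ᵥ (R *ᵥ z) := by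
  rw [← Matrix.mul_one Rᵀ, ← quadForm_mulVec, quadForm, Matrix.one_mulVec]

theorem integrable_exp_neg_quadForm {P : Matrix (Fin k) (Fin k) ℝ} (hP : P.PosDef) {c : ℝ}
    (hc : 0 < c) : Integrable fun z => Real.exp (-c * quadForm P z) := by
  obtain ⟨R, rfl, hR⟩ := exists_eq_transpose_mul_self hP
  simp only [quadForm_transpose_mul_self]
  have h := (integrable_exp_neg_dotProduct (k := k) hc).smul_measure
    (c := ENNReal.ofReal |R.det⁻¹|) ENNReal.ofReal_ne_top
  rw [← map_mulVec_volume hR, (measurableEmbedding_mulVec hR).integrable_map_iff] at h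
  exact h

theorem integral_exp_neg_half_quadForm {S : Matrix (Fin k) (Fin k) ℝ} (hS : S.PosDef) :
    ∫ z, Real.exp (-(1 / 2) * quadForm S⁻¹ z) = Real.sqrt ((2 * Real.pi) ^ k * S.det) := by
  obtain ⟨R, hPR, hR⟩ := exists_eq_transpose_mul_self hS.inv
  -- Hence the Jacobian factor `|R.det⁻¹|` is the square root of `S.det`.
  have hdet : S.det = (R.det⁻¹) ^ 2 := by
    have h := congrArg Matrix.det hPR
    rw [Matrix.det_nonsing_inv, Matrix.det_mul, Matrix.det_transpose, Ring.inverse_eq_inv'] at h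
    rw [← inv_inv S.det, h]
    field_simp
  have h := (measurableEmbedding_mulVec hR).integral_map (μ := volume)
    fun w : Fin k → ℝ => Real.exp (-(1 / 2) * (w ⬝ᵥ w))
  rw [map_mulVec_volume hR, integral_smul_measure, integral_exp_neg_half_dotProduct,
    ENNReal.toReal_ofReal (abs_nonneg _)] at h
  rw [hPR]
  simp only [quadForm_transpose_mul_self]
  rw [← h, hdet, Real.sqrt_mul (by positivity), Real.sqrt_sq_eq_abs, smul_eq_mul, mul_comm]

theorem abs_quadForm_le_dotProduct (K : Matrix (Fin k) (Fin k) ℝ) (w : Fin k → ℝ) :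
    |quadForm K w| ≤ (∑ i, ∑ j, |K i j|) * (w ⬝ᵥ w) := by
  have hle : ∀ i, w i ^ 2 ≤ w ⬝ᵥ w := fun i => by
    rw [sq]
    exact Finset.single_le_sum (f := fun i => w i * w i) (fun _ _ => mul_self_nonneg _)
      (Finset.mem_univ i)
  have hexp : quadForm K w = ∑ i, ∑ j, w i * (K i j * w j) := by
    simp only [quadForm, dotProduct, Matrix.mulVec, Finset.mul_sum]
  rw [hexp, Finset.sum_mul]
  simp only [Finset.sum_mul]
  refine (Finset.abs_sum_le_sum_abs _ _).trans (Finset.sum_le_sum fun i _ => ?_)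
  refine (Finset.abs_sum_le_sum_abs _ _).trans (Finset.sum_le_sum fun j _ => ?_)
  rw [show w i * (K i j * w j) = K i j * (w i * w j) by ring, abs_mul]
  refine mul_le_mul_of_nonneg_left ?_ (abs_nonneg _)
  rw [abs_le]
  -- `|w i * w j| ≤ (w i ^ 2 + w j ^ 2) / 2 ≤ w ⬝ᵥ w`.
  constructor <;> nlinarith [hle i, hle j, sq_nonneg (w i + w j), sq_nonneg (w i - w j)]

/-- In the coordinates `R z` the form `P` becomes the standard one, and `K` becomes a fixed form
bounded by its entries. -/
theorem exists_abs_quadForm_le {P : Matrix (Fin k) (Fin k) ℝ} (hP : P.PosDef)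
    (K : Matrix (Fin k) (Fin k) ℝ) : ∃ C : ℝ, 0 ≤ C ∧ ∀ z, |quadForm K z| ≤ C * quadForm P z := by
  obtain ⟨R, rfl, hR⟩ := exists_eq_transpose_mul_self hP
  refine ⟨∑ i, ∑ j, |((R⁻¹)ᵀ * K * R⁻¹) i j|,
    Finset.sum_nonneg fun _ _ => Finset.sum_nonneg fun _ _ => abs_nonneg _, fun z => ?_⟩
  have h := abs_quadForm_le_dotProduct ((R⁻¹)ᵀ * K * R⁻¹) (R *ᵥ z)
  rwa [← quadForm_mulVec, Matrix.mulVec_mulVec, Matrix.nonsing_inv_mul _ hR.isUnit,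
    Matrix.one_mulVec, ← quadForm_transpose_mul_self] at h

/-- Half of the Gaussian decay absorbs the growth of `g`: `1 + s ≤ 4 exp(s / 4)`, which leaves the
integrable `exp(-s / 4)`. -/
theorem integrable_exp_neg_half_quadForm_mul_of_le {P : Matrix (Fin k) (Fin k) ℝ} (hP : P.PosDef)
    {g : (Fin k → ℝ) → ℝ} (hg : Continuous g) {C : ℝ}
    (hC : ∀ z, |g z| ≤ C * (1 + quadForm P z)) :
    Integrable fun z => Real.exp (-(1 / 2) * quadForm P z) * g z := by
  have hc := continuous_quadForm P
  refine ((integrable_exp_neg_quadForm hP (c := 1 / 4) (by norm_num)).const_mul (4 * C)).mono'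
    (Continuous.aestronglyMeasurable (by fun_prop)) (Filter.Eventually.of_forall fun z => ?_)
  have hs := quadForm_nonneg hP.posSemidef z
  have hC0 : 0 ≤ C := by
    have := (abs_nonneg _).trans (hC 0)
    simpa using this
  rw [Real.norm_eq_abs, abs_mul, abs_of_pos (Real.exp_pos _)]
  have h1 : 1 + quadForm P z ≤ 4 * Real.exp (1 / 4 * quadForm P z) := by
    linarith [Real.add_one_le_exp (1 / 4 * quadForm P z)]
  calc Real.exp (-(1 / 2) * quadForm P z) * |g z|
      ≤ Real.exp (-(1 / 2) * quadForm P z) * (C * (4 * Real.exp (1 / 4 * quadForm P z))) := by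
        gcongr
        exact (hC z).trans (by gcongr)
    _ = 4 * C * (Real.exp (-(1 / 2) * quadForm P z) * Real.exp (1 / 4 * quadForm P z)) := by ring
    _ = 4 * C * Real.exp (-(1 / 4) * quadForm P z) := by
        rw [← Real.exp_add]
        ring_nf

theorem gaussianDensity_pos {S : Matrix (Fin k) (Fin k) ℝ} (hS : S.PosDef) (μ x : Fin k → ℝ) :
    0 < gaussianDensity μ S x := by
  have := hS.det_pos
  have := Real.pi_pos
  unfold gaussianDensity
  positivity

theorem continuous_gaussianDensity (μ : Fin k → ℝ) (S : Matrix (Fin k) (Fin k) ℝ) :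
    Continuous (gaussianDensity μ S) := by
  unfold gaussianDensity
  fun_prop

theorem gaussianDensity_sub (μ x : Fin k → ℝ) (S : Matrix (Fin k) (Fin k) ℝ) :
    gaussianDensity 0 S (x - μ) = gaussianDensity μ S x := by
  simp [gaussianDensity]

theorem integrable_gaussianDensity {S : Matrix (Fin k) (Fin k) ℝ} (hS : S.PosDef)
    (μ : Fin k → ℝ) : Integrable (gaussianDensity μ S) :=
  ((integrable_exp_neg_quadForm hS.inv (c := 1 / 2) (by norm_num)).comp_sub_right μ).const_mul _

theorem integral_gaussianDensity {S : Matrix (Fin k) (Fin k) ℝ} (hS : S.PosDef)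
    (μ : Fin k → ℝ) : ∫ x, gaussianDensity μ S x = 1 := by
  have hpos : 0 < Real.sqrt ((2 * Real.pi) ^ k * S.det) := by
    have := hS.det_pos
    have := Real.pi_pos
    positivity
  simp only [gaussianDensity_eq]
  rw [integral_const_mul, integral_sub_right_eq_self
    (fun x => Real.exp (-(1 / 2) * quadForm S⁻¹ x)) μ, integral_exp_neg_half_quadForm hS,
    inv_mul_cancel₀ hpos.ne']

theorem lintegral_gaussianDensity {S : Matrix (Fin k) (Fin k) ℝ} (hS : S.PosDef)
    (μ : Fin k → ℝ) : ∫⁻ x, ENNReal.ofReal (gaussianDensity μ S x) = 1 := by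
  rw [← ofReal_integral_eq_lintegral_ofReal (integrable_gaussianDensity hS μ)
    (Filter.Eventually.of_forall fun x => (gaussianDensity_pos hS μ x).le),
    integral_gaussianDensity hS, ENNReal.ofReal_one]

/-- `|s| ≤ (1 + s ^ 2) / 2` bounds the linear function by the rank-one quadratic form of `c cᵀ`. -/
theorem integrable_gaussianDensity_mul_dotProduct {S : Matrix (Fin k) (Fin k) ℝ} (hS : S.PosDef)
    (c : Fin k → ℝ) : Integrable fun z => gaussianDensity 0 S z * (c ⬝ᵥ z) := by
  obtain ⟨C, hC0, hC⟩ := exists_abs_quadForm_le hS.inv (Matrix.vecMulVec c c)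
  have h := integrable_exp_neg_half_quadForm_mul_of_le hS.inv (g := fun z => c ⬝ᵥ z) (by fun_prop)
    (C := 1 + C) fun z => by
      have h1 := hC z
      have h2 : quadForm (Matrix.vecMulVec c c) z = (c ⬝ᵥ z) ^ 2 := by
        simp [quadForm, Matrix.vecMulVec_mulVec, dotProduct_comm z c, sq]
      have h3 := quadForm_nonneg hS.inv.posSemidef z
      rw [h2, abs_of_nonneg (sq_nonneg _)] at h1
      rw [abs_le]
      constructor <;> nlinarith [sq_nonneg (c ⬝ᵥ z - 1), sq_nonneg (c ⬝ᵥ z + 1)]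
  simpa [gaussianDensity_eq, mul_assoc] using
    h.const_mul (Real.sqrt ((2 * Real.pi) ^ k * S.det))⁻¹

/-- The integrand is odd. -/
theorem integral_gaussianDensity_mul_dotProduct (S : Matrix (Fin k) (Fin k) ℝ)
    (c : Fin k → ℝ) : ∫ z, gaussianDensity 0 S z * (c ⬝ᵥ z) = 0 := by
  have h := integral_neg_eq_self (fun z => gaussianDensity 0 S z * (c ⬝ᵥ z)) volume
  have h2 : ∀ z, gaussianDensity 0 S (-z) = gaussianDensity 0 S z := fun z => by
    rw [gaussianDensity_eq, gaussianDensity_eq, sub_zero, sub_zero, quadForm_neg]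
  simp only [h2, dotProduct_neg, mul_neg, integral_neg] at h
  linarith

theorem integrable_gaussianDensity_mul_quadForm {S : Matrix (Fin k) (Fin k) ℝ} (hS : S.PosDef)
    (K : Matrix (Fin k) (Fin k) ℝ) : Integrable fun z => gaussianDensity 0 S z * quadForm K z := by
  obtain ⟨C, hC0, hC⟩ := exists_abs_quadForm_le hS.inv K
  have h := integrable_exp_neg_half_quadForm_mul_of_le hS.inv (continuous_quadForm K) (C := C)
    fun z => (hC z).trans (by nlinarith [quadForm_nonneg hS.inv.posSemidef z])
  simpa [gaussianDensity_eq, mul_assoc] using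
    h.const_mul (Real.sqrt ((2 * Real.pi) ^ k * S.det))⁻¹

/-- Expansion about the mean `μ` into quadratic, linear and constant parts in `x - μ`. -/
theorem gaussianDensity_mul_quadForm_affine (S : Matrix (Fin k) (Fin k) ℝ) (μ : Fin k → ℝ)
    (Γ : Matrix (Fin l) (Fin l) ℝ) (L : Matrix (Fin l) (Fin k) ℝ) (b : Fin l → ℝ)
    (x : Fin k → ℝ) :
    gaussianDensity μ S x * quadForm Γ (L *ᵥ x + b) =
      gaussianDensity 0 S (x - μ) * quadForm (Lᵀ * Γ * L) (x - μ) +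
        (gaussianDensity 0 S (x - μ) * ((Lᵀ *ᵥ ((Γ + Γᵀ) *ᵥ (L *ᵥ μ + b))) ⬝ᵥ (x - μ)) +
        gaussianDensity 0 S (x - μ) * quadForm Γ (L *ᵥ μ + b)) := by
  have h : L *ᵥ x + b = L *ᵥ (x - μ) + (L *ᵥ μ + b) := by
    rw [Matrix.mulVec_sub]
    abel
  rw [h, quadForm_add_right, quadForm_mulVec, Matrix.mulVec_transpose L,
    ← Matrix.dotProduct_mulVec, gaussianDensity_sub]
  ring

theorem integrable_gaussianDensity_mul_quadForm_affine {S : Matrix (Fin k) (Fin k) ℝ}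
    (hS : S.PosDef) (μ : Fin k → ℝ) (Γ : Matrix (Fin l) (Fin l) ℝ) (L : Matrix (Fin l) (Fin k) ℝ)
    (b : Fin l → ℝ) : Integrable fun x => gaussianDensity μ S x * quadForm Γ (L *ᵥ x + b) := by
  simp only [gaussianDensity_mul_quadForm_affine]
  exact ((integrable_gaussianDensity_mul_quadForm hS _).add
    ((integrable_gaussianDensity_mul_dotProduct hS _).add
      ((integrable_gaussianDensity hS 0).mul_const _))).comp_sub_right μ

/-- The second-moment integral is left unevaluated: it depends on neither `μ` nor `b`, so it only
enters the constants. -/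
theorem integral_gaussianDensity_mul_quadForm_affine {S : Matrix (Fin k) (Fin k) ℝ}
    (hS : S.PosDef) (μ : Fin k → ℝ) (Γ : Matrix (Fin l) (Fin l) ℝ) (L : Matrix (Fin l) (Fin k) ℝ)
    (b : Fin l → ℝ) :
    ∫ x, gaussianDensity μ S x * quadForm Γ (L *ᵥ x + b) =
      (∫ z, gaussianDensity 0 S z * quadForm (Lᵀ * Γ * L) z) + quadForm Γ (L *ᵥ μ + b) := by
  simp only [gaussianDensity_mul_quadForm_affine S μ]
  have h1 := integrable_gaussianDensity_mul_quadForm hS (Lᵀ * Γ * L)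
  have h2 := integrable_gaussianDensity_mul_dotProduct hS (Lᵀ *ᵥ ((Γ + Γᵀ) *ᵥ (L *ᵥ μ + b)))
  have h3 := (integrable_gaussianDensity hS 0).mul_const (quadForm Γ (L *ᵥ μ + b))
  rw [integral_sub_right_eq_self (fun z => gaussianDensity 0 S z * quadForm (Lᵀ * Γ * L) z +
      (gaussianDensity 0 S z * ((Lᵀ *ᵥ ((Γ + Γᵀ) *ᵥ (L *ᵥ μ + b))) ⬝ᵥ z) +
        gaussianDensity 0 S z * quadForm Γ (L *ᵥ μ + b))) μ,
    integral_add h1 (by exact h2.add h3), integral_add h2 h3,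
    integral_gaussianDensity_mul_dotProduct, integral_mul_const, integral_gaussianDensity hS,
    one_mul, zero_add]

end Gaussian

/-! ### The control parameters -/

section Parameters

variable {n m : ℕ}

/-- The covariance matrix `Σ_{t,ω}` in terms of `L_t` and `Σ_{t,γ}⁻¹`. -/
def LinearGaussian.omegaCov (S : LinearGaussian n m) (t : ℕ) (L Γ : Matrix (Fin n) (Fin n) ℝ) :
    Matrix (Fin n) (Fin n) ℝ :=
  ((S.SigmaIX t)⁻¹ + Lᵀ * Γ * L)⁻¹

/-- The mean `μ_{t,ω}` in terms of `L_t`, `M_t` and `Σ_{t,γ}⁻¹`. -/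
def LinearGaussian.omegaMean (S : LinearGaussian n m) (t : ℕ) (L : Matrix (Fin n) (Fin n) ℝ)
    (M : Fin n → ℝ) (Γ : Matrix (Fin n) (Fin n) ℝ) : Fin n → ℝ :=
  S.omegaCov t L Γ *ᵥ ((S.SigmaIX t)⁻¹ *ᵥ S.muIX t - (Lᵀ * Γ) *ᵥ M)

/-- The covariance matrix `Σ_{t,u}` in terms of `L_t` and `Σ_{t,γ}⁻¹`. -/
def LinearGaussian.inputCov (S : LinearGaussian n m) (t : ℕ) (L Γ : Matrix (Fin n) (Fin n) ℝ) :
    Matrix (Fin m) (Fin m) ℝ :=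
  ((S.SigmaIU t)⁻¹ + (S.B t)ᵀ * (S.omegaCov t L Γ)⁻¹ * S.B t)⁻¹

/-- The triple `(L_t, M_t, Σ_{t,γ}⁻¹)` at the time `t = T - k`. -/
def LinearGaussian.backward (S : LinearGaussian n m) (T : ℕ) :
    ℕ → Matrix (Fin n) (Fin n) ℝ × (Fin n → ℝ) × Matrix (Fin n) (Fin n) ℝ
  | 0 => (0, 0, 0)
  | k + 1 =>
    -- The matrices are those of the time following `T - (k + 1)`. In this form the index becomes `t
    -- + 1` once `T - (k + 1)` is identified with `t`.
    let t := T - (k + 1) + 1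
    let q := S.backward T k
    let Γ := (S.B t * S.SigmaIU t * (S.B t)ᵀ + S.omegaCov t q.1 q.2.2)⁻¹
    (S.A t,
      Γ⁻¹ *ᵥ (((S.omegaCov t q.1 q.2.2)⁻¹ * S.B t * S.inputCov t q.1 q.2.2 * (S.SigmaIU t)⁻¹) *ᵥ
        S.muIU t) - S.omegaMean t q.1 q.2.1 q.2.2,
      Γ)

/-- The control parameters produced by the backward recursions. -/
def LinearGaussian.parameters (S : LinearGaussian n m) (T : ℕ) : ControlParameters n m where
  SigmaU t := S.inputCov t (S.backward T (T - t)).1 (S.backward T (T - t)).2.2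
  muU t x := S.inputCov t (S.backward T (T - t)).1 (S.backward T (T - t)).2.2 *ᵥ
    ((S.SigmaIU t)⁻¹ *ᵥ S.muIU t +
      ((S.B t)ᵀ * (S.omegaCov t (S.backward T (T - t)).1 (S.backward T (T - t)).2.2)⁻¹) *ᵥ
        (S.omegaMean t (S.backward T (T - t)).1 (S.backward T (T - t)).2.1
          (S.backward T (T - t)).2.2 - S.A t *ᵥ x))
  L t := (S.backward T (T - t)).1
  M t := (S.backward T (T - t)).2.1
  SigmaGammaInv t := (S.backward T (T - t)).2.2
  SigmaOmega t := S.omegaCov t (S.backward T (T - t)).1 (S.backward T (T - t)).2.2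
  muOmega t := S.omegaMean t (S.backward T (T - t)).1 (S.backward T (T - t)).2.1
    (S.backward T (T - t)).2.2

theorem posSemidef_transpose_mul_mul {k l : ℕ} {K : Matrix (Fin k) (Fin k) ℝ} (hK : K.PosSemidef)
    (L : Matrix (Fin k) (Fin l) ℝ) : (Lᵀ * K * L).PosSemidef := by
  simpa [Matrix.conjTranspose_eq_transpose_of_trivial] using hK.conjTranspose_mul_mul_same L

theorem posSemidef_mul_mul_transpose {k l : ℕ} {K : Matrix (Fin k) (Fin k) ℝ} (hK : K.PosSemidef)
    (L : Matrix (Fin l) (Fin k) ℝ) : (L * K * Lᵀ).PosSemidef := by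
  simpa using posSemidef_transpose_mul_mul hK Lᵀ

theorem inv_inv_of_posDef {k : ℕ} {K : Matrix (Fin k) (Fin k) ℝ} (hK : K.PosDef) :
    K⁻¹⁻¹ = K :=
  Matrix.nonsing_inv_nonsing_inv K hK.det_pos.ne'.isUnit

theorem mulVec_inv_mulVec {k : ℕ} {K : Matrix (Fin k) (Fin k) ℝ} (hK : K.PosDef)
    (v : Fin k → ℝ) : K *ᵥ (K⁻¹ *ᵥ v) = v := by
  rw [Matrix.mulVec_mulVec, Matrix.mul_nonsing_inv _ hK.det_pos.ne'.isUnit, Matrix.one_mulVec]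

theorem inv_mulVec_mulVec {k : ℕ} {K : Matrix (Fin k) (Fin k) ℝ} (hK : K.PosDef)
    (v : Fin k → ℝ) : K⁻¹ *ᵥ (K *ᵥ v) = v := by
  rw [Matrix.mulVec_mulVec, Matrix.nonsing_inv_mul _ hK.det_pos.ne'.isUnit, Matrix.one_mulVec]

theorem LinearGaussian.omegaCov_inv_posDef {S : LinearGaussian n m} {t : ℕ}
    (hX : (S.SigmaIX t).PosDef) {Γ : Matrix (Fin n) (Fin n) ℝ} (hΓ : Γ.PosSemidef)
    (L : Matrix (Fin n) (Fin n) ℝ) : ((S.SigmaIX t)⁻¹ + Lᵀ * Γ * L).PosDef :=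
  hX.inv.add_posSemidef (posSemidef_transpose_mul_mul hΓ L)

theorem LinearGaussian.omegaCov_posDef {S : LinearGaussian n m} {t : ℕ}
    (hX : (S.SigmaIX t).PosDef) {Γ : Matrix (Fin n) (Fin n) ℝ} (hΓ : Γ.PosSemidef)
    (L : Matrix (Fin n) (Fin n) ℝ) : (S.omegaCov t L Γ).PosDef :=
  (omegaCov_inv_posDef hX hΓ L).inv

theorem LinearGaussian.inputCov_inv_posDef {S : LinearGaussian n m} {t : ℕ}
    (hX : (S.SigmaIX t).PosDef) (hU : (S.SigmaIU t).PosDef) {Γ : Matrix (Fin n) (Fin n) ℝ}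
    (hΓ : Γ.PosSemidef) (L : Matrix (Fin n) (Fin n) ℝ) :
    ((S.SigmaIU t)⁻¹ + (S.B t)ᵀ * (S.omegaCov t L Γ)⁻¹ * S.B t).PosDef :=
  hU.inv.add_posSemidef (posSemidef_transpose_mul_mul (omegaCov_posDef hX hΓ L).inv.posSemidef _)

theorem LinearGaussian.gammaCov_posDef {S : LinearGaussian n m} {t : ℕ}
    (hX : (S.SigmaIX t).PosDef) (hU : (S.SigmaIU t).PosDef) {Γ : Matrix (Fin n) (Fin n) ℝ}
    (hΓ : Γ.PosSemidef) (L : Matrix (Fin n) (Fin n) ℝ) :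
    (S.B t * S.SigmaIU t * (S.B t)ᵀ + S.omegaCov t L Γ).PosDef :=
  (omegaCov_posDef hX hΓ L).posSemidef_add (posSemidef_mul_mul_transpose hU.posSemidef _)

/-- The matrix `Σ_{t,γ}⁻¹` is zero at the horizon, so the property carried backwards is
semidefiniteness. Adding the positive definite ideal precisions makes every inverse taken along the
way genuine. -/
theorem LinearGaussian.parameters_recursion {S : LinearGaussian n m} {T : ℕ}
    (hX : ∀ t, 1 ≤ t → t ≤ T → (S.SigmaIX t).PosDef)
    (hU : ∀ t, 1 ≤ t → t ≤ T → (S.SigmaIU t).PosDef) : (S.parameters T).Recursion S T := by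
  have hback : ∀ k ≤ T, (S.backward T k).2.2.PosSemidef := by
    intro k
    induction k with
    | zero => exact fun _ => Matrix.PosSemidef.zero
    | succ k ih =>
      intro hk
      exact (gammaCov_posDef (hX _ (by omega) (by omega)) (hU _ (by omega) (by omega))
        (ih (by omega)) _).inv.posSemidef
  have hstep : ∀ t < T, S.backward T (T - t) = S.backward T (T - (t + 1) + 1) := fun t ht => by
    congr 1
    omega
  have htime : ∀ t < T, T - (T - (t + 1) + 1) = t := fun t ht => by omega
  have hΓ : ∀ t < T, (S.backward T (T - (t + 1))).2.2.PosSemidef := fun t _ => hback _ (by omega)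
  have hX' : ∀ t < T, (S.SigmaIX (t + 1)).PosDef := fun t ht => hX _ (by omega) (by omega)
  have hU' : ∀ t < T, (S.SigmaIU (t + 1)).PosDef := fun t ht => hU _ (by omega) (by omega)
  refine ⟨?_, ?_, ?_, ?_, ?_, ?_, ?_, ?_, ?_, ?_, ?_, ?_, ?_⟩
  · simp [parameters, backward]
  · simp [parameters, backward]
  · simp [parameters, backward]
  · exact fun t ht => omegaCov_posDef (hX' t ht) (hΓ t ht) _
  · exact fun t ht => (inputCov_inv_posDef (hX' t ht) (hU' t ht) (hΓ t ht) _).inv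
  · intro t ht
    simp only [parameters, hstep t ht, backward, htime t ht]
    exact (gammaCov_posDef (hX' t ht) (hU' t ht) (hΓ t ht) _).inv
  · exact fun t ht => inv_inv_of_posDef (omegaCov_inv_posDef (hX' t ht) (hΓ t ht) _)
  · exact fun t ht => rfl
  · exact fun t ht => inv_inv_of_posDef (inputCov_inv_posDef (hX' t ht) (hU' t ht) (hΓ t ht) _)
  · exact fun t ht x => rfl
  · intro t ht
    simp only [parameters, hstep t ht, backward, htime t ht]
  · intro t ht
    simp only [parameters, hstep t ht, backward, htime t ht]
  · intro t ht
    simp only [parameters, hstep t ht, backward, htime t ht]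

end Parameters

/-! ### The Gaussian input update -/

section Update

variable {n m : ℕ}

/-- Completing the square in the input: the posterior and the marginal quadratic forms. -/
theorem quadForm_posterior_marginal {S U : Matrix (Fin m) (Fin m) ℝ} {Ω : Matrix (Fin n) (Fin n) ℝ}
    {B : Matrix (Fin n) (Fin m) ℝ} (hS : S.PosDef) (hU : U.PosDef) (hΩ : Ω.PosDef)
    (hUinv : U⁻¹ = S⁻¹ + Bᵀ * Ω⁻¹ * B) (μ : Fin m → ℝ) (c : Fin n → ℝ) (u : Fin m → ℝ) :
    quadForm S⁻¹ (u - μ) + quadForm Ω⁻¹ (B *ᵥ u + c) =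
      quadForm U⁻¹ (u - U *ᵥ (S⁻¹ *ᵥ μ - (Bᵀ * Ω⁻¹) *ᵥ c)) +
        quadForm (B * S * Bᵀ + Ω)⁻¹ (B *ᵥ μ + c) := by
  have hN : (B * S * Bᵀ + Ω).PosDef :=
    hΩ.posSemidef_add (posSemidef_mul_mul_transpose hS.posSemidef B)
  -- Expressing everything through `v` avoids the Woodbury formula: the minimizer in `u` is `μ - S
  -- Bᵀ v`, and the residual there is `Ω v`.
  set v := (B * S * Bᵀ + Ω)⁻¹ *ᵥ (B *ᵥ μ + c) with hv
  have he : B *ᵥ μ + c = (B * S * Bᵀ) *ᵥ v + Ω *ᵥ v := by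
    rw [← Matrix.add_mulVec, hv, mulVec_inv_mulVec hN]
  have hc : c = (B * S * Bᵀ) *ᵥ v + Ω *ᵥ v - B *ᵥ μ := by
    rw [← he]
    abel
  have hν : U *ᵥ (S⁻¹ *ᵥ μ - (Bᵀ * Ω⁻¹) *ᵥ c) = μ - (S * Bᵀ) *ᵥ v := by
    have h : S⁻¹ *ᵥ μ - (Bᵀ * Ω⁻¹) *ᵥ c = U⁻¹ *ᵥ (μ - (S * Bᵀ) *ᵥ v) := by
      have h1 : S⁻¹ *ᵥ ((S * Bᵀ) *ᵥ v) = Bᵀ *ᵥ v := by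
        rw [← Matrix.mulVec_mulVec, inv_mulVec_mulVec hS]
      have h2 : (Bᵀ * Ω⁻¹) *ᵥ (Ω *ᵥ v) = Bᵀ *ᵥ v := by
        rw [← Matrix.mulVec_mulVec, inv_mulVec_mulVec hΩ]
      have h3 : (Bᵀ * Ω⁻¹ * B) *ᵥ ((S * Bᵀ) *ᵥ v) = (Bᵀ * Ω⁻¹) *ᵥ ((B * S * Bᵀ) *ᵥ v) := by
        simp only [Matrix.mulVec_mulVec, Matrix.mul_assoc]
      rw [hUinv, hc, Matrix.add_mulVec, Matrix.mulVec_sub, Matrix.mulVec_sub, Matrix.mulVec_sub,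
        Matrix.mulVec_add, h1, h2, h3, Matrix.mulVec_mulVec μ (Bᵀ * Ω⁻¹) B]
      abel
    rw [h, mulVec_inv_mulVec hU]
  have hsq := quadForm_sub_add_quadForm (ν := μ - (S * Bᵀ) *ᵥ v) hS.inv.isHermitian
    hΩ.inv.isHermitian hUinv (by rw [← hν, inv_mulVec_mulVec hU]) u
  rw [hsq, hν]
  congr 1
  have h1 : μ - (S * Bᵀ) *ᵥ v - μ = -((S * Bᵀ) *ᵥ v) := by abel
  have h2 : B *ᵥ (μ - (S * Bᵀ) *ᵥ v) + c = Ω *ᵥ v := by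
    rw [Matrix.mulVec_sub, hc, Matrix.mulVec_mulVec, Matrix.mul_assoc]
    abel
  have h3 : ∀ {k : ℕ} {K : Matrix (Fin k) (Fin k) ℝ}, K.PosDef → Kᵀ * K⁻¹ * K = K := fun hK => by
    rw [transpose_eq_of_isHermitian hK.isHermitian,
      Matrix.mul_nonsing_inv _ hK.det_pos.ne'.isUnit, Matrix.one_mul]
  have h4 : (S * Bᵀ)ᵀ * S⁻¹ * (S * Bᵀ) = B * S * Bᵀ := by
    calc (S * Bᵀ)ᵀ * S⁻¹ * (S * Bᵀ) = B * (Sᵀ * S⁻¹ * S) * Bᵀ := by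
          simp only [Matrix.transpose_mul, Matrix.transpose_transpose, Matrix.mul_assoc]
      _ = B * S * Bᵀ := by rw [h3 hS]
  clear_value v
  -- The minimum is `vᵀ B S Bᵀ v + vᵀ Ω v`, which is the marginal form evaluated at `(B S Bᵀ + Ω) v
  -- = B μ + c`.
  rw [h1, h2, quadForm_neg, quadForm_mulVec, quadForm_mulVec, h4, h3 hΩ, ← quadForm_add_left,
    he, ← Matrix.add_mulVec, quadForm_mulVec, h3 hN]

/-- Push-through identity: `(B S Bᵀ + Ω) Ω⁻¹ B = B S U⁻¹`. It collapses the recursion for `M`. -/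
theorem gain_eq {S U : Matrix (Fin m) (Fin m) ℝ} {Ω : Matrix (Fin n) (Fin n) ℝ}
    {B : Matrix (Fin n) (Fin m) ℝ} (hS : S.PosDef) (hU : U.PosDef) (hΩ : Ω.PosDef)
    (hUinv : U⁻¹ = S⁻¹ + Bᵀ * Ω⁻¹ * B) :
    (B * S * Bᵀ + Ω) * (Ω⁻¹ * B * U * S⁻¹) = B := by
  have h1 : (B * S * Bᵀ + Ω) * (Ω⁻¹ * B) = B * S * U⁻¹ := by
    rw [hUinv, Matrix.add_mul, Matrix.mul_add, ← Matrix.mul_assoc Ω,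
      Matrix.mul_nonsing_inv _ hΩ.det_pos.ne'.isUnit, Matrix.one_mul,
      Matrix.mul_assoc B S S⁻¹, Matrix.mul_nonsing_inv _ hS.det_pos.ne'.isUnit, Matrix.mul_one,
      add_comm]
    simp only [Matrix.mul_assoc]
  calc (B * S * Bᵀ + Ω) * (Ω⁻¹ * B * U * S⁻¹)
      = (B * S * Bᵀ + Ω) * (Ω⁻¹ * B) * U * S⁻¹ := by simp only [Matrix.mul_assoc]
    _ = B * S * (U⁻¹ * U) * S⁻¹ := by rw [h1]; simp only [Matrix.mul_assoc]
    _ = B := by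
      rw [Matrix.nonsing_inv_mul _ hU.det_pos.ne'.isUnit, Matrix.mul_one, Matrix.mul_assoc,
        Matrix.mul_nonsing_inv _ hS.det_pos.ne'.isUnit, Matrix.mul_one]

end Update

/-! ### The functions `ω` and `γ` in the linear-Gaussian case -/

section LinearGaussianControl

variable {n m T : ℕ} {S : LinearGaussian n m} {p : ControlParameters n m}

theorem ControlParameters.Recursion.posSemidef_SigmaGammaInv (hp : p.Recursion S T) {t : ℕ}
    (ht : t ≤ T) : (p.SigmaGammaInv t).PosSemidef := by
  rcases ht.lt_or_eq with h | rfl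
  · exact (hp.SigmaGammaInv_posDef t h).posSemidef
  · rw [hp.SigmaGammaInv_terminal]
    exact Matrix.PosSemidef.zero

/-- With this form of `M t`, the vector `L_t x + M_t` is the residual `A x + B u - μ_ω` at the ideal
mean of `u`. -/
theorem ControlParameters.Recursion.offset_eq (hp : p.Recursion S T) {t : ℕ} (ht : t < T)
    (hU : (S.SigmaIU (t + 1)).PosDef) :
    p.M t = S.B (t + 1) *ᵥ S.muIU (t + 1) - p.muOmega (t + 1) := by
  have hN : (S.B (t + 1) * S.SigmaIU (t + 1) * (S.B (t + 1))ᵀ + p.SigmaOmega (t + 1)).PosDef :=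
    (hp.SigmaOmega_posDef t ht).posSemidef_add (posSemidef_mul_mul_transpose hU.posSemidef _)
  rw [hp.M_eq t ht, hp.SigmaGammaInv_eq t ht, inv_inv_of_posDef hN, Matrix.mulVec_mulVec,
    gain_eq hU (hp.SigmaU_posDef t ht) (hp.SigmaOmega_posDef t ht) (hp.SigmaU_inv t ht)]

theorem log_gaussianDensity {k : ℕ} {Sig : Matrix (Fin k) (Fin k) ℝ} (hSig : Sig.PosDef)
    (μ x : Fin k → ℝ) : Real.log (gaussianDensity μ Sig x) =
      Real.log (Real.sqrt ((2 * Real.pi) ^ k * Sig.det))⁻¹ - 1 / 2 * quadForm Sig⁻¹ (x - μ) := by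
  have hpos : 0 < Real.sqrt ((2 * Real.pi) ^ k * Sig.det) := by
    have := hSig.det_pos
    have := Real.pi_pos
    positivity
  rw [gaussianDensity_eq, Real.log_mul (inv_pos.2 hpos).ne' (Real.exp_ne_zero _), Real.log_exp]
  ring

/-- The Gaussian form of `γ(d(t))`. -/
def ControlParameters.gammaForm (p : ControlParameters n m) (t : ℕ) (C : ℝ) (d : Dataset n m t) :
    ℝ :=
  C * Real.exp (-(1 / 2) * quadForm (p.SigmaGammaInv t) (p.L t *ᵥ d.state + p.M t))

/-- The logarithm in `ω` is quadratic in `y`, and averaging over `y` evaluates each form at the mean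
`a = A x + B u`, up to constants. The form of `f` itself vanishes at its mean; the other two combine
by completing the square in `a`. -/
theorem omega_eq_quadForm (hXi : S.SigmaXi.PosDef) {t : ℕ} (ht : t < T)
    (hX : (S.SigmaIX (t + 1)).PosDef) (hp : p.Recursion S T) {C : ℝ} (hC : 0 < C)
    (hγ : ∀ d, gamma T S.model S.idealModel S.idealPolicy (t + 1) d = p.gammaForm (t + 1) C d) :
    ∃ κ : ℝ, ∀ (d : Dataset n m t) (u : Fin m → ℝ),
      Integrable (omegaIntegrand S.model S.idealModel t
        (gamma T S.model S.idealModel S.idealPolicy (t + 1)) d u) ∧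
      omega T S.model S.idealModel S.idealPolicy t d u =
        κ + 1 / 2 * quadForm (p.SigmaOmega (t + 1))⁻¹
          (S.B (t + 1) *ᵥ u + (S.A (t + 1) *ᵥ d.state - p.muOmega (t + 1))) := by
  set Γ := p.SigmaGammaInv (t + 1)
  set L := p.L (t + 1)
  set M := p.M (t + 1)
  set cf := Real.log (Real.sqrt ((2 * Real.pi) ^ n * S.SigmaXi.det))⁻¹
  set cI := Real.log (Real.sqrt ((2 * Real.pi) ^ n * (S.SigmaIX (t + 1)).det))⁻¹
  have hΓ : Γ.PosSemidef := hp.posSemidef_SigmaGammaInv ht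
  have hν : (p.SigmaOmega (t + 1))⁻¹ *ᵥ p.muOmega (t + 1) =
      (S.SigmaIX (t + 1))⁻¹ *ᵥ S.muIX (t + 1) - (Lᵀ * Γ) *ᵥ M := by
    rw [hp.muOmega_eq t ht, inv_mulVec_mulVec (hp.SigmaOmega_posDef t ht)]
  have hform : ∀ (d : Dataset n m t) (u : Fin m → ℝ) (y : Fin n → ℝ),
      omegaIntegrand S.model S.idealModel t
        (gamma T S.model S.idealModel S.idealPolicy (t + 1)) d u y =
      gaussianDensity (S.A (t + 1) *ᵥ d.state + S.B (t + 1) *ᵥ u) S.SigmaXi y *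
          (cf - cI - Real.log C) +
        (1 / 2 * (gaussianDensity (S.A (t + 1) *ᵥ d.state + S.B (t + 1) *ᵥ u) S.SigmaXi y *
            quadForm (S.SigmaIX (t + 1))⁻¹ (1 *ᵥ y + -S.muIX (t + 1))) +
        (1 / 2 * (gaussianDensity (S.A (t + 1) *ᵥ d.state + S.B (t + 1) *ᵥ u) S.SigmaXi y *
            quadForm Γ (L *ᵥ y + M)) +
        -(1 / 2) * (gaussianDensity (S.A (t + 1) *ᵥ d.state + S.B (t + 1) *ᵥ u) S.SigmaXi y *
            quadForm S.SigmaXi⁻¹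
              (1 *ᵥ y + -(S.A (t + 1) *ᵥ d.state + S.B (t + 1) *ᵥ u))))) := by
    intro d u y
    have h1 := gaussianDensity_pos hXi (S.A (t + 1) *ᵥ d.state + S.B (t + 1) *ᵥ u) y
    have h2 := gaussianDensity_pos hX (S.muIX (t + 1)) y
    rw [omegaIntegrand, hγ, ControlParameters.gammaForm, Dataset.snoc_state, LinearGaussian.model,
      LinearGaussian.idealModel, Real.log_div h1.ne' (by positivity),
      Real.log_mul (by positivity) h2.ne', Real.log_mul hC.ne' (Real.exp_ne_zero _), Real.log_exp,
      log_gaussianDensity hXi, log_gaussianDensity hX, Matrix.one_mulVec, ← sub_eq_add_neg,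
      ← sub_eq_add_neg]
    ring
  -- `κ` collects the log normalizers, the three second-moment integrals and the minimum of the
  -- completed square.
  refine ⟨cf - cI - Real.log C +
    1 / 2 * (∫ z, gaussianDensity 0 S.SigmaXi z * quadForm (1ᵀ * (S.SigmaIX (t + 1))⁻¹ * 1) z) +
    1 / 2 * (∫ z, gaussianDensity 0 S.SigmaXi z * quadForm (Lᵀ * Γ * L) z) -
    1 / 2 * (∫ z, gaussianDensity 0 S.SigmaXi z * quadForm (1ᵀ * S.SigmaXi⁻¹ * 1) z) +
    1 / 2 * (quadForm (S.SigmaIX (t + 1))⁻¹ (p.muOmega (t + 1) - S.muIX (t + 1)) +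
      quadForm Γ (L *ᵥ p.muOmega (t + 1) + M)), fun d u => ?_⟩
  have hsq := quadForm_sub_add_quadForm hX.inv.isHermitian hΓ.isHermitian (hp.SigmaOmega_inv t ht)
    hν (S.A (t + 1) *ᵥ d.state + S.B (t + 1) *ᵥ u)
  set a := S.A (t + 1) *ᵥ d.state + S.B (t + 1) *ᵥ u with ha
  have h0 := (integrable_gaussianDensity hXi a).mul_const (cf - cI - Real.log C)
  have h1 := (integrable_gaussianDensity_mul_quadForm_affine hXi a (S.SigmaIX (t + 1))⁻¹ 1
    (-S.muIX (t + 1))).const_mul (1 / 2)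
  have h2 := (integrable_gaussianDensity_mul_quadForm_affine hXi a Γ L M).const_mul (1 / 2)
  have h3 := (integrable_gaussianDensity_mul_quadForm_affine hXi a S.SigmaXi⁻¹ 1 (-a)).const_mul
    (-(1 / 2))
  have hfun := funext (hform d u)
  refine ⟨by rw [hfun]; exact h0.add (h1.add (h2.add h3)), ?_⟩
  have hb : S.B (t + 1) *ᵥ u + (S.A (t + 1) *ᵥ d.state - p.muOmega (t + 1)) =
      a - p.muOmega (t + 1) := by
    rw [ha]
    abel
  rw [omega, hfun, integral_add h0 (by exact h1.add (h2.add h3)),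
    integral_add h1 (by exact h2.add h3), integral_add h2 h3, integral_mul_const,
    integral_const_mul, integral_const_mul, integral_const_mul, integral_gaussianDensity hXi,
    integral_gaussianDensity_mul_quadForm_affine hXi,
    integral_gaussianDensity_mul_quadForm_affine hXi,
    integral_gaussianDensity_mul_quadForm_affine hXi, Matrix.one_mulVec,
    add_neg_cancel, quadForm_zero_right, ← sub_eq_add_neg, hb]
  linear_combination (1 / 2) * hsq

/-- Bayes' rule for Gaussians: prior times likelihood is marginal times posterior. The constant is
`exp(-κ)` times the ratio of the prior and posterior normalizations. -/
theorem idealPolicy_mul_exp_neg_omega {t : ℕ} (ht : t < T) (hU : (S.SigmaIU (t + 1)).PosDef)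
    (hp : p.Recursion S T) {κ : ℝ}
    (hω : ∀ (d : Dataset n m t) (u : Fin m → ℝ),
      omega T S.model S.idealModel S.idealPolicy t d u =
        κ + 1 / 2 * quadForm (p.SigmaOmega (t + 1))⁻¹
          (S.B (t + 1) *ᵥ u + (S.A (t + 1) *ᵥ d.state - p.muOmega (t + 1)))) :
    ∃ C : ℝ, 0 < C ∧ ∀ (d : Dataset n m t) (u : Fin m → ℝ),
      S.idealPolicy t d u * Real.exp (-omega T S.model S.idealModel S.idealPolicy t d u) =
        p.gammaForm t C d * p.policy t d u := by
  have hSU := hp.SigmaU_posDef t ht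
  have hI : 0 < Real.sqrt ((2 * Real.pi) ^ m * (S.SigmaIU (t + 1)).det) := by
    have := hU.det_pos
    have := Real.pi_pos
    positivity
  have hO : 0 < Real.sqrt ((2 * Real.pi) ^ m * (p.SigmaU (t + 1)).det) := by
    have := hSU.det_pos
    have := Real.pi_pos
    positivity
  refine ⟨(Real.sqrt ((2 * Real.pi) ^ m * (S.SigmaIU (t + 1)).det))⁻¹ * Real.exp (-κ) *
    Real.sqrt ((2 * Real.pi) ^ m * (p.SigmaU (t + 1)).det), by positivity, fun d u => ?_⟩
  have hsq := quadForm_posterior_marginal hU hSU (hp.SigmaOmega_posDef t ht) (hp.SigmaU_inv t ht)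
    (S.muIU (t + 1)) (S.A (t + 1) *ᵥ d.state - p.muOmega (t + 1)) u
  have hmean : p.SigmaU (t + 1) *ᵥ ((S.SigmaIU (t + 1))⁻¹ *ᵥ S.muIU (t + 1) -
      ((S.B (t + 1))ᵀ * (p.SigmaOmega (t + 1))⁻¹) *ᵥ
        (S.A (t + 1) *ᵥ d.state - p.muOmega (t + 1))) = p.muU (t + 1) d.state := by
    rw [hp.muU_eq t ht, sub_eq_add_neg, ← Matrix.mulVec_neg, neg_sub]
  have hlin : S.B (t + 1) *ᵥ S.muIU (t + 1) + (S.A (t + 1) *ᵥ d.state - p.muOmega (t + 1)) =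
      p.L t *ᵥ d.state + p.M t := by
    rw [hp.L_eq t ht, hp.offset_eq ht hU]
    abel
  rw [hmean, hlin, ← hp.SigmaGammaInv_eq t ht] at hsq
  rw [hω, LinearGaussian.idealPolicy, ControlParameters.policy, ControlParameters.gammaForm,
    gaussianDensity_eq, gaussianDensity_eq]
  have hexp : Real.exp (-(1 / 2) * quadForm (S.SigmaIU (t + 1))⁻¹ (u - S.muIU (t + 1))) *
      Real.exp (-(κ + 1 / 2 * quadForm (p.SigmaOmega (t + 1))⁻¹
        (S.B (t + 1) *ᵥ u + (S.A (t + 1) *ᵥ d.state - p.muOmega (t + 1))))) =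
      Real.exp (-κ) * Real.exp (-(1 / 2) * quadForm (p.SigmaGammaInv t)
        (p.L t *ᵥ d.state + p.M t)) *
        Real.exp (-(1 / 2) * quadForm (p.SigmaU (t + 1))⁻¹ (u - p.muU (t + 1) d.state)) := by
    rw [← Real.exp_add, ← Real.exp_add, ← Real.exp_add]
    congr 1
    linear_combination (-(1 / 2)) * hsq
  rw [mul_assoc, hexp]
  field_simp

theorem gamma_eq_of_tilt {t : ℕ} (ht : t < T) (hp : p.Recursion S T) {C : ℝ}
    (htilt : ∀ (d : Dataset n m t) (u : Fin m → ℝ),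
      S.idealPolicy t d u * Real.exp (-omega T S.model S.idealModel S.idealPolicy t d u) =
        p.gammaForm t C d * p.policy t d u) (d : Dataset n m t) :
    gamma T S.model S.idealModel S.idealPolicy t d = p.gammaForm t C d := by
  rw [gamma_of_lt T _ _ _ t ht]
  simp only [htilt]
  rw [integral_const_mul]
  simp only [ControlParameters.policy]
  rw [integral_gaussianDensity (hp.SigmaU_posDef t ht), mul_one]

theorem exists_gamma_eq (hXi : S.SigmaXi.PosDef)
    (hX : ∀ t, 1 ≤ t → t ≤ T → (S.SigmaIX t).PosDef)
    (hU : ∀ t, 1 ≤ t → t ≤ T → (S.SigmaIU t).PosDef) (hp : p.Recursion S T) :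
    ∀ k ≤ T, ∃ C : ℝ, 0 < C ∧ ∀ d : Dataset n m (T - k),
      gamma T S.model S.idealModel S.idealPolicy (T - k) d = p.gammaForm (T - k) C d := by
  intro k
  induction k with
  | zero =>
    refine fun _ => ⟨1, one_pos, fun d => ?_⟩
    change gamma T S.model S.idealModel S.idealPolicy T d = p.gammaForm T 1 d
    rw [ControlParameters.gammaForm, hp.L_terminal, hp.M_terminal]
    simp [gamma_terminal]
  | succ k ih =>
    intro hk
    have ht : T - (k + 1) < T := by omega
    obtain ⟨C, hC, hγ⟩ := ih (by omega)
    have e : T - k = T - (k + 1) + 1 := by omega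
    rw [e] at hγ
    obtain ⟨κ, hκ⟩ := omega_eq_quadForm hXi ht (hX _ (by omega) (by omega)) hp hC hγ
    obtain ⟨C', hC', htilt⟩ := idealPolicy_mul_exp_neg_omega ht (hU _ (by omega) (by omega)) hp
      fun d u => (hκ d u).2
    exact ⟨C', hC', gamma_eq_of_tilt ht hp htilt⟩

theorem isPositiveModel_model (hXi : S.SigmaXi.PosDef) : IsPositiveModel T S.model where
  measurable t _ := by
    refine Continuous.measurable ?_
    simp only [LinearGaussian.model, gaussianDensity]
    fun_prop
  pos t _ x u y := gaussianDensity_pos hXi _ _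
  lintegral t _ x u := lintegral_gaussianDensity hXi _

theorem isPositiveModel_idealModel (hX : ∀ t, 1 ≤ t → t ≤ T → (S.SigmaIX t).PosDef) :
    IsPositiveModel T S.idealModel where
  measurable t _ := by
    refine Continuous.measurable ?_
    simp only [LinearGaussian.idealModel, gaussianDensity]
    fun_prop
  pos t ht x u y := gaussianDensity_pos (hX _ (by omega) ht) _ _
  lintegral t ht x u := lintegral_gaussianDensity (hX _ (by omega) ht) _

theorem idealPolicy_pos (hU : ∀ t, 1 ≤ t → t ≤ T → (S.SigmaIU t).PosDef) :
    ∀ t < T, ∀ (d : Dataset n m t) u, 0 < S.idealPolicy t d u :=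
  fun _ ht _ _ => gaussianDensity_pos (hU _ (by omega) ht) _ _

theorem isAdmissible_idealPolicy (hU : ∀ t, 1 ≤ t → t ≤ T → (S.SigmaIU t).PosDef) :
    IsAdmissible T S.idealPolicy := fun t ht =>
  ⟨(continuous_gaussianDensity _ _).measurable.comp measurable_snd,
    fun d u => (idealPolicy_pos hU t ht d u).le,
    fun _ => lintegral_gaussianDensity (hU _ (by omega) ht) _⟩

theorem measurable_gammaForm (p : ControlParameters n m) (t : ℕ) (C : ℝ) :
    Measurable (p.gammaForm t C) := by
  have hq := continuous_quadForm (p.SigmaGammaInv t)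
  have hc : Continuous fun x : Fin n → ℝ =>
      C * Real.exp (-(1 / 2) * quadForm (p.SigmaGammaInv t) (p.L t *ᵥ x + p.M t)) := by fun_prop
  exact hc.measurable.comp Dataset.measurable_state

theorem gammaForm_pos (p : ControlParameters n m) {t : ℕ} {C : ℝ} (hC : 0 < C)
    (d : Dataset n m t) : 0 < p.gammaForm t C d := by
  unfold ControlParameters.gammaForm
  positivity

end LinearGaussianControl

/-! ### The dynamic programming equations for `ω` and `γ` -/

section DynamicProgramming

variable {n m T : ℕ} {f fI : Model n m} {πI : Policy n m}

theorem integrable_of_lintegral_ofReal_eq_one {α : Type*} [MeasurableSpace α] {μ : Measure α}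
    {g : α → ℝ} (hg : Measurable g) (hg0 : ∀ x, 0 ≤ g x)
    (hg1 : ∫⁻ x, ENNReal.ofReal (g x) ∂μ = 1) : Integrable g μ ∧ ∫ x, g x ∂μ = 1 := by
  have hint : Integrable g μ := by
    refine ⟨hg.aestronglyMeasurable, ?_⟩
    rw [hasFiniteIntegral_iff_ofReal (Filter.Eventually.of_forall hg0), hg1]
    exact ENNReal.one_lt_top
  refine ⟨hint, ?_⟩
  rw [integral_eq_lintegral_of_nonneg_ae (Filter.Eventually.of_forall hg0)
    hg.aestronglyMeasurable, hg1, ENNReal.toReal_one]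

/-- Adding `fI - f`, whose integral is zero, makes the integrand of `ω` a sum of pointwise
nonnegative terms, so its Bochner and Lebesgue integrals agree. -/
theorem omega_nonneg_and_energy_eq (hf : IsPositiveModel T f) (hfI : IsPositiveModel T fI) {t : ℕ}
    (ht : t < T) (d : Dataset n m t) (u : Fin m → ℝ)
    (hγ0 : ∀ d, 0 < gamma T f fI πI (t + 1) d) (hγ1 : ∀ d, gamma T f fI πI (t + 1) d ≤ 1)
    (hint : Integrable (omegaIntegrand f fI t (gamma T f fI πI (t + 1)) d u)) :
    0 ≤ omega T f fI πI t d u ∧ ENNReal.ofReal (omega T f fI πI t d u) =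
      ∫⁻ y, (ENNReal.ofReal (klTerm (f (t + 1) d.state u y) (fI (t + 1) d.state u y)) +
        ENNReal.ofReal (f (t + 1) d.state u y) *
          ENNReal.ofReal (-Real.log (gamma T f fI πI (t + 1) (d.snoc u y)))) := by
  obtain ⟨hif, hf1⟩ := integrable_of_lintegral_ofReal_eq_one
    (hf.measurable_section ht d.state u) (fun y => (hf.pos t ht _ _ y).le) (hf.lintegral t ht _ _)
  obtain ⟨hifI, hfI1⟩ := integrable_of_lintegral_ofReal_eq_one
    (hfI.measurable_section ht d.state u) (fun y => (hfI.pos t ht _ _ y).le)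
    (hfI.lintegral t ht _ _)
  have hpt : ∀ y, omegaIntegrand f fI t (gamma T f fI πI (t + 1)) d u y +
      (fI (t + 1) d.state u y - f (t + 1) d.state u y) =
      klTerm (f (t + 1) d.state u y) (fI (t + 1) d.state u y) + f (t + 1) d.state u y *
        -Real.log (gamma T f fI πI (t + 1) (d.snoc u y)) := by
    intro y
    have h1 := hf.pos t ht d.state u y
    have h2 := hfI.pos t ht d.state u y
    rw [omegaIntegrand, klTerm_eq h2, mul_comm (gamma _ _ _ _ _ _), ← div_div,
      Real.log_div (div_pos h1 h2).ne' (hγ0 _).ne']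
    ring
  have hk : ∀ y, 0 ≤ klTerm (f (t + 1) d.state u y) (fI (t + 1) d.state u y) := fun y =>
    klTerm_nonneg (hf.pos t ht _ _ y).le (hfI.pos t ht _ _ y)
  have hV : ∀ y, 0 ≤ -Real.log (gamma T f fI πI (t + 1) (d.snoc u y)) := fun y =>
    neg_nonneg.2 (Real.log_nonpos (hγ0 _).le (hγ1 _))
  have hnn : ∀ y, 0 ≤ klTerm (f (t + 1) d.state u y) (fI (t + 1) d.state u y) +
      f (t + 1) d.state u y * -Real.log (gamma T f fI πI (t + 1) (d.snoc u y)) := fun y =>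
    add_nonneg (hk y) (mul_nonneg (hf.pos t ht _ _ y).le (hV y))
  have hsum : Integrable fun y => omegaIntegrand f fI t (gamma T f fI πI (t + 1)) d u y +
      (fI (t + 1) d.state u y - f (t + 1) d.state u y) := hint.add (hifI.sub hif)
  have hω : omega T f fI πI t d u = ∫ y, (klTerm (f (t + 1) d.state u y)
      (fI (t + 1) d.state u y) +
      f (t + 1) d.state u y * -Real.log (gamma T f fI πI (t + 1) (d.snoc u y))) := by
    simp only [← hpt]
    rw [integral_add hint (by exact hifI.sub hif), integral_sub hifI hif, hf1, hfI1, sub_self,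
      add_zero, omega]
  refine ⟨hω ▸ integral_nonneg hnn, ?_⟩
  simp only [hpt] at hsum
  rw [hω, ofReal_integral_eq_lintegral_ofReal hsum (Filter.Eventually.of_forall hnn)]
  refine lintegral_congr fun y => ?_
  rw [ENNReal.ofReal_add (hk y) (mul_nonneg (hf.pos t ht _ _ y).le (hV y)),
    ENNReal.ofReal_mul (hf.pos t ht _ _ y).le]

/-- Backward induction: `γ ≤ 1` at time `t + 1` gives `ω ≥ 0`, and then `γ` at time `t` is an
average of `exp(-ω) ≤ 1`. -/
theorem gamma_le_one (hf : IsPositiveModel T f) (hfI : IsPositiveModel T fI)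
    (hπI : IsAdmissible T πI) (hγ0 : ∀ t ≤ T, ∀ d, 0 < gamma T f fI πI t d)
    (hint : ∀ t < T, ∀ d u,
      Integrable (omegaIntegrand f fI t (gamma T f fI πI (t + 1)) d u)) :
    ∀ k ≤ T, ∀ d : Dataset n m (T - k), gamma T f fI πI (T - k) d ≤ 1 := by
  intro k
  induction k with
  | zero => exact fun _ d => (gamma_terminal T f fI πI d).le
  | succ k ih =>
    intro hk d
    have ht : T - (k + 1) < T := by omega
    have ih' := ih (by omega)
    have e : T - k = T - (k + 1) + 1 := by omega
    rw [e] at ih'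
    obtain ⟨hi, h1⟩ := integrable_of_lintegral_ofReal_eq_one (hπI.measurable_section ht d)
      ((hπI _ ht).2.1 d) ((hπI _ ht).2.2 d)
    rw [gamma_of_lt T f fI πI _ ht, ← h1]
    refine integral_mono_of_nonneg (Filter.Eventually.of_forall fun u =>
      mul_nonneg ((hπI _ ht).2.1 d u) (Real.exp_pos _).le) hi
      (Filter.Eventually.of_forall fun u => ?_)
    refine mul_le_of_le_one_right ((hπI _ ht).2.1 d u) (Real.exp_le_one_iff.2 (neg_nonpos.2 ?_))
    exact (omega_nonneg_and_energy_eq hf hfI ht d u (hγ0 _ ht) ih' (hint _ ht d u)).1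

theorem isValue_neg_log_gamma (hf : IsPositiveModel T f) (hfI : IsPositiveModel T fI)
    (hπI : IsAdmissible T πI) (hγ0 : ∀ t ≤ T, ∀ d, 0 < gamma T f fI πI t d)
    (hγm : ∀ t ≤ T, Measurable (gamma T f fI πI t))
    (hωm : ∀ t < T, Measurable fun q : Dataset n m t × (Fin m → ℝ) => omega T f fI πI t q.1 q.2)
    (hint : ∀ t < T, ∀ d u,
      Integrable (omegaIntegrand f fI t (gamma T f fI πI (t + 1)) d u))
    (hone : ∀ t < T, ∀ d, ∫⁻ u, ENNReal.ofReal (fpcPolicy T f fI πI t d u) = 1) :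
    IsValue T f fI πI (fun t d => -Real.log (gamma T f fI πI t d)) (omega T f fI πI) := by
  have hγ1 : ∀ t ≤ T, ∀ d, gamma T f fI πI t d ≤ 1 := by
    intro t ht
    have h := gamma_le_one hf hfI hπI hγ0 hint (T - t) (by omega)
    rwa [Nat.sub_sub_self ht] at h
  have henergy := fun t (ht : t < T) d u =>
    omega_nonneg_and_energy_eq hf hfI ht d u (hγ0 (t + 1) ht) (hγ1 (t + 1) ht) (hint t ht d u)
  refine ⟨fun t ht => (hγm t ht).log.neg,
    fun t ht d => neg_nonneg.2 (Real.log_nonpos (hγ0 t ht d).le (hγ1 t ht d)),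
    fun d => by simp [gamma_terminal], hωm, fun t ht d u => (henergy t ht d u).1,
    fun t ht d u => (henergy t ht d u).2, fun t ht d => ?_⟩
  rw [← hone t ht d]
  refine lintegral_congr fun u => ?_
  rw [fpcPolicy, Real.exp_neg (Real.log _), Real.exp_log (hγ0 t ht.le d), div_eq_mul_inv]

theorem klCost_congr {π ρ : Policy n m} (h : ∀ t < T, ∀ d u, ρ t d u = π t d u)
    (x₀ : Fin n → ℝ) : klCost T f fI πI ρ x₀ = klCost T f fI πI π x₀ := by
  have hj : jointDensity T f ρ x₀ = jointDensity T f π x₀ := by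
    funext y
    refine Finset.prod_congr rfl fun i _ => ?_
    rw [h i i.isLt]
  simp only [klCost, jointLaw, hj]

/-- Needed because the Gaussian and tilted strategies are compared only at times below the horizon.
-/
theorem IsOptimal.congr {π ρ : Policy n m} (hπ : IsOptimal T f fI πI π)
    (h : ∀ t < T, ∀ d u, ρ t d u = π t d u) : IsOptimal T f fI πI ρ := by
  have hfun : ∀ t < T, ρ t = π t := fun t ht => funext fun d => funext fun u => h t ht d u
  refine ⟨fun t ht => by rw [hfun t ht]; exact hπ.1 t ht, fun x₀ => ?_⟩
  obtain ⟨h1, h2⟩ := hπ.2 x₀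
  rw [klCost_congr h]
  refine ⟨h1, fun π' hπ' => ⟨(h2 π' hπ').1, fun heq t ht => ?_⟩⟩
  rw [hfun t ht]
  exact (h2 π' hπ').2 heq t ht

end DynamicProgramming

end FPC

end

theorem mainTheorem1 (n m T : ℕ) (S : FPC.LinearGaussian n m)
    (hXi : S.SigmaXi.PosDef)
    (hX : ∀ t, 1 ≤ t → t ≤ T → (S.SigmaIX t).PosDef)
    (hU : ∀ t, 1 ≤ t → t ≤ T → (S.SigmaIU t).PosDef) :
    ∃ p : FPC.ControlParameters n m,
      -- the parameters are given by the backward recursions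
      p.Recursion S T ∧
      -- the integrals that define `ω` and `γ` converge
      (∀ t < T, ∀ d : FPC.Dataset n m t,
        (∀ u, Integrable (FPC.omegaIntegrand S.model S.idealModel t
          (FPC.gamma T S.model S.idealModel S.idealPolicy (t + 1)) d u)) ∧
        Integrable (fun u => S.idealPolicy t d u *
          Real.exp (-FPC.omega T S.model S.idealModel S.idealPolicy t d u))) ∧
      -- the form of `γ`
      (∃ C : ℕ → ℝ, ∀ t ≤ T, 0 < C t ∧ ∀ d : FPC.Dataset n m t,
        FPC.gamma T S.model S.idealModel S.idealPolicy t d =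
          C t * Real.exp (-(1 / 2) * ((p.L t *ᵥ d.state + p.M t) ⬝ᵥ
            (p.SigmaGammaInv t *ᵥ (p.L t *ᵥ d.state + p.M t))))) ∧
      -- the strategy built from `ω` and `γ` is `𝒩(μ_{t,u}, Σ_{t,u})`
      (∀ t < T, ∀ (d : FPC.Dataset n m t) (u : Fin m → ℝ),
        FPC.fpcPolicy T S.model S.idealModel S.idealPolicy t d u = p.policy t d u) ∧
      -- and it is the optimal admissible strategy
      FPC.IsOptimal T S.model S.idealModel S.idealPolicy p.policy := by
  have hp : (S.parameters T).Recursion S T := FPC.LinearGaussian.parameters_recursion hX hU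
  -- From here on only the recursion matters, not how its solution was built.
  generalize S.parameters T = p at hp
  have hγ : ∀ t, ∃ C : ℝ, t ≤ T → 0 < C ∧ ∀ d : FPC.Dataset n m t,
      FPC.gamma T S.model S.idealModel S.idealPolicy t d = p.gammaForm t C d := by
    intro t
    by_cases ht : t ≤ T
    · have h := FPC.exists_gamma_eq hXi hX hU hp (T - t) (by omega)
      rw [Nat.sub_sub_self ht] at h
      obtain ⟨C, hC⟩ := h
      exact ⟨C, fun _ => hC⟩
    · exact ⟨0, fun h => absurd h ht⟩
  choose C hC using hγ
  have hω := fun t (ht : t < T) => FPC.omega_eq_quadForm hXi ht (hX _ (by omega) ht) hp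
    (hC (t + 1) ht).1 (hC (t + 1) ht).2
  have htilt : ∀ t < T, ∀ (d : FPC.Dataset n m t) (u : Fin m → ℝ),
      S.idealPolicy t d u * Real.exp (-FPC.omega T S.model S.idealModel S.idealPolicy t d u) =
        FPC.gamma T S.model S.idealModel S.idealPolicy t d * p.policy t d u := by
    intro t ht d u
    obtain ⟨κ, hκ⟩ := hω t ht
    -- `C'` need not be matched with `C t`: `gamma_eq_of_tilt` identifies `γ` with the form that has
    -- constant `C'`.
    obtain ⟨C', -, h⟩ := FPC.idealPolicy_mul_exp_neg_omega ht (hU _ (by omega) ht) hp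
      fun d u => (hκ d u).2
    rw [h, FPC.gamma_eq_of_tilt ht hp h]
  have hint : ∀ t < T, ∀ (d : FPC.Dataset n m t) u,
      Integrable (FPC.omegaIntegrand S.model S.idealModel t
        (FPC.gamma T S.model S.idealModel S.idealPolicy (t + 1)) d u) := fun t ht d u =>
    let ⟨_, hκ⟩ := hω t ht
    (hκ d u).1
  have hγ0 : ∀ t ≤ T, ∀ d : FPC.Dataset n m t,
      0 < FPC.gamma T S.model S.idealModel S.idealPolicy t d := fun t ht d => by
    rw [(hC t ht).2]
    exact FPC.gammaForm_pos p (hC t ht).1 d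
  have hpol : ∀ t < T, ∀ (d : FPC.Dataset n m t) (u : Fin m → ℝ),
      FPC.fpcPolicy T S.model S.idealModel S.idealPolicy t d u = p.policy t d u := by
    intro t ht d u
    rw [FPC.fpcPolicy, htilt t ht, mul_div_cancel_left₀ _ (hγ0 t ht.le d).ne']
  refine ⟨p, hp, fun t ht d => ⟨hint t ht d, ?_⟩, ⟨C, fun t ht => hC t ht⟩, hpol, ?_⟩
  · simp only [htilt t ht]
    exact (FPC.integrable_gaussianDensity (hp.SigmaU_posDef t ht) _).const_mul _
  · have hf : FPC.IsPositiveModel T S.model := FPC.isPositiveModel_model hXi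
    have hfI := FPC.isPositiveModel_idealModel hX
    have hπI := FPC.isAdmissible_idealPolicy hU
    have hωm : ∀ t < T, Measurable fun q : FPC.Dataset n m t × (Fin m → ℝ) =>
        FPC.omega T S.model S.idealModel S.idealPolicy t q.1 q.2 := by
      intro t ht
      obtain ⟨κ, hκ⟩ := hω t ht
      have hq := FPC.continuous_quadForm (p.SigmaOmega (t + 1))⁻¹
      have hc : Continuous fun q : (Fin n → ℝ) × (Fin m → ℝ) =>
          κ + 1 / 2 * FPC.quadForm (p.SigmaOmega (t + 1))⁻¹
            (S.B (t + 1) *ᵥ q.2 + (S.A (t + 1) *ᵥ q.1 - p.muOmega (t + 1))) := by fun_prop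
      have hs : Measurable fun q : FPC.Dataset n m t × (Fin m → ℝ) => (q.1.state, q.2) :=
        (FPC.Dataset.measurable_state.comp measurable_fst).prodMk measurable_snd
      have he : (fun q : FPC.Dataset n m t × (Fin m → ℝ) =>
          FPC.omega T S.model S.idealModel S.idealPolicy t q.1 q.2) =
          (fun q => κ + 1 / 2 * FPC.quadForm (p.SigmaOmega (t + 1))⁻¹
            (S.B (t + 1) *ᵥ q.2 + (S.A (t + 1) *ᵥ q.1 - p.muOmega (t + 1)))) ∘
            fun q => (q.1.state, q.2) :=
        funext fun q => (hκ q.1 q.2).2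
      rw [he]
      exact hc.measurable.comp hs
    have hV := FPC.isValue_neg_log_gamma hf hfI hπI hγ0
      (fun t ht => by
        rw [funext (hC t ht).2]
        exact FPC.measurable_gammaForm p t (C t))
      hωm
      hint
      (fun t ht d => by
        simp only [hpol t ht]
        exact FPC.lintegral_gaussianDensity (hp.SigmaU_posDef t ht) _)
    refine (FPC.isOptimal_tiltPolicy hf hfI hπI (FPC.idealPolicy_pos hU) hV).congr
      fun t ht d u => ?_
    rw [← hpol t ht, FPC.fpcPolicy, FPC.tiltPolicy, Real.exp_neg (Real.log _),
      Real.exp_log (hγ0 t ht.le d), div_eq_mul_inv]
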